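/- **Theorem.** Let $\varepsilon_0,\varepsilon,\tau>0$, $\lambda\in\mathbb R\setminus\{0\}$, $\beta>0$, and put $\Delta=\varepsilon-\varepsilon_0$, $\eta=\left(\frac{\Delta\tau}{2\pi}\right)^2$, $\xi=\left(\frac{\lambda\tau}{\pi}\right)^2$, $p_{\rm at}(-)=\frac{1}{1+e^{-\beta\varepsilon}}$, $p_{\rm at}(+)=\frac{e^{-\beta\varepsilon}}{1+e^{-\beta\varepsilon}}$. Assume the non-resonant condition: there are no positive integers $n,k$ with $\xi n+\eta=k^2$. Let $\mathcal H=\ell^2(\mathbb N)$ be the bosonic Fock space over $\mathbb C$ with Fock basis $(|n\rangle)_{n\in\mathbb N}$, number operator $N|n\rangle=n|n\rangle$, and $a|n\rangle=\sqrt n\,|n-1\rangle$, $a^*|n\rangle=\sqrt{n+1}\,|n+1\rangle$. Let $\mathcal J_1$ be the set of density operators on $\mathcal H$ (positive trace class operators with trace $1$), with the trace-norm distance $\|\rho-\varrho\|_1$ and its Borel $\sigma$-algebra $\mathfrak B$. Let $\omega\in\mathbb R$ be arbitrary, let $\delta\in\mathbb R$ satisfy $\delta^2=\eta$, and define bounded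 operators on $\mathcal H$ by $$V_{--}=p_{\rm at}(-)^{1/2}e^{-i\tau\omega N}C(N),\qquad V_{-+}=p_{\rm at}(-)^{1/2}e^{-i\tau\omega N}S(N+1)\,a,$$ $$V_{+-}=p_{\rm at}(+)^{1/2}e^{-i\tau\omega N}S(N)\,a^*,\qquad V_{++}=p_{\rm at}(+)^{1/2}e^{-i\tau\omega N}C(N+1)^*,$$ $$C(n)=\cos(\pi\sqrt{\xi n+\eta})+i\,\delta\,\frac{\sin(\pi\sqrt{\xi n+\eta})}{\sqrt{\xi n+\eta}},\qquad S(n)=\xi^{1/2}\,\frac{\sin(\pi\sqrt{\xi n+\eta})}{\sqrt{\xi n+\eta}}$$ (if $\xi n+\eta=0$ the second term of $C(n)$ is $0$). These are the Kraus operators of the one-atom maser model; $\omega=\varepsilon$, $\delta=\sqrt\eta$ and $\omega=\varepsilon_0$, $\delta=\frac{\Delta\tau}{2\pi}$ are both allowed. Let $\Pi$ be the Markov kernel of the quantum trajectory on $\mathcal J_1$, $$\Pi(\rho,S)=\sum_{y\in\{-,+\}^2}\mathbf 1_S\!\left(\frac{V_y\rho V_y^*}{{\rm Tr}(V_y\rho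 V_y^*)}\right){\rm Tr}(V_y\rho V_y^*),\qquad \rho\in\mathcal J_1,\ S\in\mathfrak B,$$ where terms with ${\rm Tr}(V_y\rho V_y^*)=0$ are $0$, and write $\nu\Pi(S)=\int\Pi(\rho,S)\,d\nu(\rho)$. Let $\rho_{\rm inv}=e^{-\beta\varepsilon N}/{\rm Tr}(e^{-\beta\varepsilon N})$ and $$\nu_{\rm inv}=\sum_{n=0}^{\infty}\langle n,\rho_{\rm inv}n\rangle\,\delta_{|n\rangle\langle n|}.$$ Then $\nu_{\rm inv}$ is a probability measure on $(\mathcal J_1,\mathfrak B)$, and it is the unique probability measure $\nu$ with $\nu\Pi=\nu$. Moreover, for every probability measure $\nu$ on $(\mathcal J_1,\mathfrak B)$, $$\lim_{t\to\infty}W_1(\nu\Pi^t,\nu_{\rm inv})=0,\qquad W_1(\nu_1,\nu_2)=\sup\left\{\int f\,d\nu_1-\int f\,d\nu_2\ :\ f:\mathcal J_1\to\mathbb R,\ |f(\rho)-f(\varrho)|\le\|\rho-\varrho\|_1\right\},$$ and $\nu\Pi^t$ converges weakly to $\nu_{\rm inv}$, i.e. $\int f\,d(\nu\Pi^t)\to\int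 f\,d\nu_{\rm inv}$ for every bounded continuous $f:\mathcal J_1\to\mathbb R$. -/

import Mathlib

open MeasureTheory ProbabilityTheory Filter Topology
open scoped ENNReal InnerProductSpace

/-! ### Trace norm and density operators -/

section TraceClass

set_option linter.unusedSectionVars false

variable {ι : Type*} {H : Type*} [NormedAddCommGroup H] [InnerProductSpace ℂ H] [CompleteSpace H]

/-- The absolute value `|T| = (T* T)^{1/2}` of a bounded operator. -/
noncomputable def opAbs (T : H →L[ℂ] H) : H →L[ℂ] H := CFC.abs T

/-- The trace norm `‖T‖₁ = Tr |T|`, computed in the orthonormal basis `b`, with value `∞` when `T`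
is not trace class. -/
noncomputable def traceNorm (b : HilbertBasis ι ℂ H) (T : H →L[ℂ] H) : ℝ≥0∞ :=
  ∑' i, ENNReal.ofReal (RCLike.re ⟪b i, opAbs T (b i)⟫_ℂ)

/-- The trace `∑ᵢ ⟨bᵢ, T bᵢ⟩`. -/
noncomputable def opTrace (b : HilbertBasis ι ℂ H) (T : H →L[ℂ] H) : ℂ :=
  ∑' i, ⟪b i, T (b i)⟫_ℂ

/-- The squared Hilbert-Schmidt norm. -/
noncomputable def hsSq (b : HilbertBasis ι ℂ H) (A : H →L[ℂ] H) : ℝ≥0∞ :=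
  ∑' i, ‖A (b i)‖ₑ ^ 2

theorem parseval_enorm (b : HilbertBasis ι ℂ H) (x : H) :
    ‖x‖ₑ ^ 2 = ∑' j, ‖⟪b j, x⟫_ℂ‖ₑ ^ 2 := by
  have h2 : (2 : ℝ≥0∞).toReal = ((2 : ℕ) : ℝ) := by simp
  have h := lp.hasSum_norm (p := 2) (by simp) (b.repr x)
  simp only [h2, Real.rpow_natCast, LinearIsometryEquiv.norm_map, b.repr_apply_apply] at h
  have e : ∀ {E : Type _} [NormedAddCommGroup E] (y : E), ‖y‖ₑ ^ 2 = ENNReal.ofReal (‖y‖ ^ 2) := by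
    intro E _ y
    rw [← ofReal_norm, ENNReal.ofReal_pow (norm_nonneg _)]
  rw [e, ← h.tsum_eq, ENNReal.ofReal_tsum_of_nonneg (fun _ => by positivity) h.summable]
  refine tsum_congr fun j => ?_
  rw [← ofReal_norm, ENNReal.ofReal_pow (norm_nonneg _)]

theorem hsSq_adjoint (b : HilbertBasis ι ℂ H) (A : H →L[ℂ] H) :
    hsSq b (ContinuousLinearMap.adjoint A) = hsSq b A := by
  unfold hsSq
  simp_rw [parseval_enorm b]
  rw [ENNReal.tsum_comm]
  refine tsum_congr fun i => tsum_congr fun j => ?_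
  rw [ContinuousLinearMap.adjoint_inner_right]
  rw [← ofReal_norm, ← ofReal_norm, norm_inner_symm]

theorem hsSq_left_le (b : HilbertBasis ι ℂ H) (A C : H →L[ℂ] H) (hC : ‖C‖ ≤ 1) :
    hsSq b (C * A) ≤ hsSq b A := by
  refine ENNReal.tsum_le_tsum fun i => ?_
  gcongr
  rw [← ofReal_norm, ← ofReal_norm]
  apply ENNReal.ofReal_le_ofReal
  calc ‖C (A (b i))‖ ≤ ‖C‖ * ‖A (b i)‖ := C.le_opNorm _
    _ ≤ 1 * ‖A (b i)‖ := by gcongr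
    _ = _ := one_mul _

theorem hsSq_right_le (b : HilbertBasis ι ℂ H) (A C : H →L[ℂ] H) (hC : ‖C‖ ≤ 1) :
    hsSq b (A * C) ≤ hsSq b A := by
  rw [← hsSq_adjoint, ← hsSq_adjoint b A]
  have : ContinuousLinearMap.adjoint (A * C)
      = ContinuousLinearMap.adjoint C * ContinuousLinearMap.adjoint A :=
    ContinuousLinearMap.adjoint_comp A C
  rw [this]
  exact hsSq_left_le b _ _ (by rwa [LinearIsometryEquiv.norm_map])

theorem opAbs_nonneg (T : H →L[ℂ] H) : 0 ≤ opAbs T := CFC.abs_nonneg T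

theorem opAbs_isPositive (T : H →L[ℂ] H) : (opAbs T).IsPositive :=
  (ContinuousLinearMap.nonneg_iff_isPositive _).1 (opAbs_nonneg T)

theorem inner_opAbs_opAbs (T : H →L[ℂ] H) (x y : H) :
    ⟪opAbs T x, opAbs T y⟫_ℂ = ⟪T x, T y⟫_ℂ := by
  rw [← ContinuousLinearMap.adjoint_inner_right T, (opAbs_isPositive T).inner_left_eq_inner_right]
  have := CFC.abs_mul_abs T
  exact congrArg (fun S : H →L[ℂ] H => ⟪x, S y⟫_ℂ) this

theorem opAbs_of_isPositive {T : H →L[ℂ] H} (hT : T.IsPositive) : opAbs T = T :=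
  CFC.abs_of_nonneg T ((ContinuousLinearMap.nonneg_iff_isPositive _).2 hT)

/-- A positive operator is a square `A² = P` with `A` self-adjoint. -/
theorem exists_sqrt {P : H →L[ℂ] H} (hP : P.IsPositive) :
    ∃ A : H →L[ℂ] H, A * A = P ∧ ∀ x y, ⟪A x, y⟫_ℂ = ⟪x, A y⟫_ℂ := by
  refine ⟨CFC.sqrt P, CFC.sqrt_mul_sqrt_self P
    ((ContinuousLinearMap.nonneg_iff_isPositive _).2 hP), ?_⟩
  exact ((ContinuousLinearMap.nonneg_iff_isPositive _).1
    (CFC.sqrt_nonneg P)).inner_left_eq_inner_right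

theorem traceSum_eq_hsSq (b : HilbertBasis ι ℂ H) {A P : H →L[ℂ] H} (h : A * A = P)
    (hs : ∀ x y, ⟪A x, y⟫_ℂ = ⟪x, A y⟫_ℂ) :
    ∑' i, ENNReal.ofReal (RCLike.re ⟪b i, P (b i)⟫_ℂ) = hsSq b A := by
  refine tsum_congr fun i => ?_
  subst h
  have : (A * A) (b i) = A (A (b i)) := rfl
  rw [this, ← hs, inner_self_eq_norm_sq, ENNReal.ofReal_pow (norm_nonneg _), ofReal_norm]

/-- An approximate polar decomposition: `U = T (|T| + ε)⁻¹`. -/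
theorem exists_approx_polar (T : H →L[ℂ] H) {ε : ℝ} (hε : 0 < ε) :
    ∃ U : H →L[ℂ] H, ‖U‖ ≤ 1 ∧ (∀ x, T x = U (opAbs T x) + (ε : ℂ) • U x) ∧
      ∀ x, ‖x‖ = 1 → RCLike.re ⟪x, opAbs T x⟫_ℂ ≤ RCLike.re ⟪U x, T x⟫_ℂ + ε := by
  set P := opAbs T with hP
  have hPp : P.IsPositive := opAbs_isPositive T
  have hsym := hPp.inner_left_eq_inner_right
  set Q : H →L[ℂ] H := P + (ε : ℂ) • 1 with hQ
  have hQu : IsUnit Q := by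
    have h1 : IsStrictlyPositive ((ε : ℂ) • (1 : H →L[ℂ] H)) := by
      have hpos : ((ε : ℂ) • (1 : H →L[ℂ] H)).IsPositive :=
        ContinuousLinearMap.isPositive_one.smul_of_nonneg (by exact_mod_cast hε.le)
      have hne : (ε : ℂ) ≠ 0 := by exact_mod_cast hε.ne'
      refine ⟨(ContinuousLinearMap.nonneg_iff_isPositive _).2 hpos, ?_⟩
      exact (isUnit_one (M := H →L[ℂ] H)).smul (Units.mk0 _ hne)
    exact (h1.nonneg_add (opAbs_nonneg T)).isUnit
  obtain ⟨u, hu⟩ := hQu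
  set R : H →L[ℂ] H := ↑u⁻¹ with hR
  have hQR : ∀ x, Q (R x) = x := fun x => by
    have : Q * R = 1 := by rw [← hu]; exact u.mul_inv
    exact congrArg (fun S : H →L[ℂ] H => S x) this
  have hRQ : ∀ x, R (Q x) = x := fun x => by
    have : R * Q = 1 := by rw [← hu]; exact u.inv_mul
    exact congrArg (fun S : H →L[ℂ] H => S x) this
  have hQx : ∀ x, Q x = P x + (ε : ℂ) • x := fun x => by simp [hQ]
  have hle : ∀ y, ‖P y‖ ≤ ‖Q y‖ := fun y => by
    have h0 : 0 ≤ RCLike.re ⟪P y, (ε : ℂ) • y⟫_ℂ := by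
      rw [inner_smul_right]
      have := hPp.re_inner_nonneg_left y
      have h3 : RCLike.re ((ε : ℂ) * ⟪P y, y⟫_ℂ) = ε * RCLike.re ⟪P y, y⟫_ℂ := by
        simp
      rw [h3]; positivity
    have h4 := norm_add_sq (𝕜 := ℂ) (P y) ((ε : ℂ) • y)
    rw [← hQx] at h4
    refine le_of_sq_le_sq ?_ (norm_nonneg _)
    nlinarith [sq_nonneg ‖(ε : ℂ) • y‖]
  have hTP : ∀ y, ‖T y‖ = ‖P y‖ := fun y => by
    have h5 := inner_opAbs_opAbs T y y
    have h6 := congrArg RCLike.re h5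
    rw [inner_self_eq_norm_sq, inner_self_eq_norm_sq] at h6
    exact ((sq_eq_sq₀ (norm_nonneg _) (norm_nonneg _)).1 h6).symm
  refine ⟨T * R, ?_, ?_, ?_⟩
  · refine ContinuousLinearMap.opNorm_le_bound _ zero_le_one fun x => ?_
    calc ‖T (R x)‖ = ‖P (R x)‖ := hTP _
      _ ≤ ‖Q (R x)‖ := hle _
      _ = 1 * ‖x‖ := by rw [hQR, one_mul]
  · intro x
    have : (T * R) (P x) + (ε : ℂ) • (T * R) x = T (R (Q x)) := by
      rw [hQx]; simp
    rw [this, hRQ]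
  · intro x hx
    have h1 : ⟪(T * R) x, T x⟫_ℂ = ⟪x, P x⟫_ℂ - (ε : ℂ) * ⟪P (R x), x⟫_ℂ := by
      calc ⟪T (R x), T x⟫_ℂ = ⟪P (R x), P x⟫_ℂ := (inner_opAbs_opAbs T _ _).symm
        _ = ⟪P (R x), Q x⟫_ℂ - (ε : ℂ) * ⟪P (R x), x⟫_ℂ := by
            rw [hQx, inner_add_right, inner_smul_right]; ring
        _ = _ := by
            congr 1
            have h2 : ⟪P (R x), Q x⟫_ℂ = ⟪Q (R x), P x⟫_ℂ := by
              rw [hQx, hQx, inner_add_right, inner_add_left, inner_smul_right, inner_smul_left,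
                hsym (R x) x]
              simp
            rw [h2, hQR]
    have h3 : ‖⟪P (R x), x⟫_ℂ‖ ≤ 1 := by
      calc ‖⟪P (R x), x⟫_ℂ‖ ≤ ‖P (R x)‖ * ‖x‖ := norm_inner_le_norm _ _
        _ ≤ ‖Q (R x)‖ * ‖x‖ := by gcongr; exact hle _
        _ = 1 := by rw [hQR, hx, one_mul]
    have h4 : RCLike.re ((ε : ℂ) * ⟪P (R x), x⟫_ℂ) ≤ ε := by
      have : RCLike.re ((ε : ℂ) * ⟪P (R x), x⟫_ℂ) = ε * RCLike.re ⟪P (R x), x⟫_ℂ := by simp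
      rw [this]
      have := (RCLike.re_le_norm (⟪P (R x), x⟫_ℂ)).trans h3
      nlinarith
    rw [h1, map_sub]
    linarith

theorem norm_sum_inner_le_traceNorm (b : HilbertBasis ι ℂ H) (T B D : H →L[ℂ] H)
    (hB : ‖B‖ ≤ 1) (hD : ‖D‖ ≤ 1) (s : Finset ι) :
    ‖∑ i ∈ s, ⟪B (b i), T (D (b i))⟫_ℂ‖ₑ ≤ traceNorm b T := by
  obtain ⟨A, hA, hAs⟩ := exists_sqrt (opAbs_isPositive T)
  have htn : traceNorm b T = hsSq b A := traceSum_eq_hsSq b hA hAs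
  have key : ∀ ε : ℝ, 0 < ε →
      ‖∑ i ∈ s, ⟪B (b i), T (D (b i))⟫_ℂ‖ₑ ≤ traceNorm b T + ENNReal.ofReal (s.card * ε) := by
    intro ε hε
    obtain ⟨U, hU, hT, -⟩ := exists_approx_polar T hε
    set V := ContinuousLinearMap.adjoint U with hV
    have hV1 : ‖V‖ ≤ 1 := by rw [hV, LinearIsometryEquiv.norm_map]; exact hU
    have hVB : ‖V * B‖ ≤ 1 := (norm_mul_le _ _).trans (mul_le_one₀ hV1 (norm_nonneg _) hB)
    have hb : ∀ i, ‖b i‖ = 1 := fun i => b.orthonormal.1 i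
    have hterm : ∀ i, ‖⟪B (b i), T (D (b i))⟫_ℂ‖ ≤
        (‖(A * (V * B)) (b i)‖ ^ 2 + ‖(A * D) (b i)‖ ^ 2) / 2 + ε := by
      intro i
      have e1 : ⟪B (b i), T (D (b i))⟫_ℂ =
          ⟪(A * (V * B)) (b i), (A * D) (b i)⟫_ℂ + (ε : ℂ) * ⟪B (b i), U (D (b i))⟫_ℂ := by
        rw [hT, inner_add_right, inner_smul_right]
        congr 1
        rw [← hA, ← ContinuousLinearMap.adjoint_inner_left U]
        exact (hAs _ _).symm
      have e2 : ‖⟪B (b i), U (D (b i))⟫_ℂ‖ ≤ 1 := by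
        have g1 : ‖B (b i)‖ ≤ 1 := by
          have := B.le_opNorm (b i); rw [hb, mul_one] at this; exact this.trans hB
        have g2 : ‖D (b i)‖ ≤ 1 := by
          have := D.le_opNorm (b i); rw [hb, mul_one] at this; exact this.trans hD
        have g3 : ‖U (D (b i))‖ ≤ 1 :=
          (U.le_opNorm _).trans (mul_le_one₀ hU (norm_nonneg _) g2)
        exact (norm_inner_le_norm _ _).trans (mul_le_one₀ g1 (norm_nonneg _) g3)
      have e3 : ‖⟪(A * (V * B)) (b i), (A * D) (b i)⟫_ℂ‖ ≤
          (‖(A * (V * B)) (b i)‖ ^ 2 + ‖(A * D) (b i)‖ ^ 2) / 2 := by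
        have := norm_inner_le_norm (𝕜 := ℂ) ((A * (V * B)) (b i)) ((A * D) (b i))
        nlinarith [sq_nonneg (‖(A * (V * B)) (b i)‖ - ‖(A * D) (b i)‖)]
      rw [e1]
      refine (norm_add_le _ _).trans ?_
      have e4 : ‖(ε : ℂ) * ⟪B (b i), U (D (b i))⟫_ℂ‖ ≤ ε := by
        rw [norm_mul, Complex.norm_real, Real.norm_of_nonneg hε.le]
        nlinarith
      linarith
    have hsum : ‖∑ i ∈ s, ⟪B (b i), T (D (b i))⟫_ℂ‖ ≤
        (∑ i ∈ s, ‖(A * (V * B)) (b i)‖ ^ 2 + ∑ i ∈ s, ‖(A * D) (b i)‖ ^ 2) / 2 + s.card * ε := by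
      refine (norm_sum_le _ _).trans ((Finset.sum_le_sum fun i _ => hterm i).trans (le_of_eq ?_))
      rw [Finset.sum_add_distrib, ← Finset.sum_div, Finset.sum_add_distrib]
      simp
    have hs1 : ∀ C : H →L[ℂ] H, ‖C‖ ≤ 1 →
        ENNReal.ofReal (∑ i ∈ s, ‖(A * C) (b i)‖ ^ 2) ≤ traceNorm b T := by
      intro C hC
      rw [htn, ENNReal.ofReal_sum_of_nonneg (fun _ _ => by positivity)]
      refine le_trans ?_ (hsSq_right_le b A C hC)
      refine le_trans (le_of_eq ?_) (ENNReal.sum_le_tsum s)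
      refine Finset.sum_congr rfl fun i _ => ?_
      rw [ENNReal.ofReal_pow (norm_nonneg _), ofReal_norm]
    rcases eq_or_ne (traceNorm b T) ⊤ with htop | htop
    · rw [htop]; simp
    have h1 := (ENNReal.ofReal_le_iff_le_toReal htop).1 (hs1 _ hVB)
    have h2 := (ENNReal.ofReal_le_iff_le_toReal htop).1 (hs1 _ hD)
    rw [← ofReal_norm, ← ENNReal.ofReal_toReal htop,
      ← ENNReal.ofReal_add ENNReal.toReal_nonneg (by positivity)]
    apply ENNReal.ofReal_le_ofReal
    linarith
  refine ENNReal.le_of_forall_pos_le_add fun δ hδ _ => ?_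
  have hc : (0 : ℝ) < s.card + 1 := by positivity
  have h := key (δ / (s.card + 1)) (div_pos (by exact_mod_cast hδ) hc)
  refine h.trans (add_le_add le_rfl ?_)
  rw [← ENNReal.ofReal_coe_nnreal]
  apply ENNReal.ofReal_le_ofReal
  rw [mul_div_assoc', div_le_iff₀ hc]
  have : (0 : ℝ) ≤ δ := δ.2
  nlinarith

theorem traceNorm_le_of_forall (b : HilbertBasis ι ℂ H) (T : H →L[ℂ] H) (C : ℝ≥0∞)
    (h : ∀ (K : H →L[ℂ] H) (s : Finset ι), ‖K‖ ≤ 1 → ‖∑ i ∈ s, ⟪K (b i), T (b i)⟫_ℂ‖ₑ ≤ C) :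
    traceNorm b T ≤ C := by
  unfold traceNorm
  rw [ENNReal.tsum_eq_iSup_sum]
  refine iSup_le fun s => ?_
  refine ENNReal.le_of_forall_pos_le_add fun δ hδ _ => ?_
  have hc : (0 : ℝ) < s.card + 1 := by positivity
  have hδ' : (0 : ℝ) < δ := by exact_mod_cast hδ
  obtain ⟨U, hU, -, hre⟩ := exists_approx_polar T (div_pos hδ' hc)
  rw [← ENNReal.ofReal_sum_of_nonneg
    (fun i _ => (opAbs_isPositive T).re_inner_nonneg_right (b i))]
  have h1 : ∑ i ∈ s, RCLike.re ⟪b i, opAbs T (b i)⟫_ℂ ≤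
      ‖∑ i ∈ s, ⟪U (b i), T (b i)⟫_ℂ‖ + δ := by
    have h2 : ∑ i ∈ s, RCLike.re ⟪b i, opAbs T (b i)⟫_ℂ ≤
        ∑ i ∈ s, (RCLike.re ⟪U (b i), T (b i)⟫_ℂ + δ / (s.card + 1)) :=
      Finset.sum_le_sum fun i _ => hre (b i) (b.orthonormal.1 i)
    rw [Finset.sum_add_distrib, Finset.sum_const, nsmul_eq_mul] at h2
    have h3 : (s.card : ℝ) * (δ / (s.card + 1)) ≤ δ := by
      rw [mul_div_assoc', div_le_iff₀ hc]
      nlinarith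
    have h4 := RCLike.re_le_norm (∑ i ∈ s, ⟪U (b i), T (b i)⟫_ℂ)
    rw [map_sum] at h4
    linarith
  refine (ENNReal.ofReal_le_ofReal h1).trans ?_
  rw [ENNReal.ofReal_add (norm_nonneg _) hδ'.le, ofReal_norm,
    ENNReal.ofReal_coe_nnreal]
  exact add_le_add (h U s hU) le_rfl

theorem norm_one_le_one : ‖(1 : H →L[ℂ] H)‖ ≤ 1 :=
  ContinuousLinearMap.opNorm_le_bound _ zero_le_one fun x => by simp

theorem traceNorm_add_le (b : HilbertBasis ι ℂ H) (S T : H →L[ℂ] H) :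
    traceNorm b (S + T) ≤ traceNorm b S + traceNorm b T := by
  refine traceNorm_le_of_forall b _ _ fun K s hK => ?_
  have : ∑ i ∈ s, ⟪K (b i), (S + T) (b i)⟫_ℂ =
      ∑ i ∈ s, ⟪K (b i), S (b i)⟫_ℂ + ∑ i ∈ s, ⟪K (b i), T (b i)⟫_ℂ := by
    rw [← Finset.sum_add_distrib]
    exact Finset.sum_congr rfl fun i _ => by rw [add_apply, inner_add_right]
  rw [this]
  refine (enorm_add_le _ _).trans (add_le_add ?_ ?_)
  · exact norm_sum_inner_le_traceNorm b S K 1 hK norm_one_le_one s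
  · exact norm_sum_inner_le_traceNorm b T K 1 hK norm_one_le_one s

theorem traceNorm_zero (b : HilbertBasis ι ℂ H) : traceNorm b (0 : H →L[ℂ] H) = 0 := by
  simp [traceNorm, opAbs]

theorem traceNorm_smul (b : HilbertBasis ι ℂ H) (c : ℂ) (T : H →L[ℂ] H) :
    traceNorm b (c • T) = ‖c‖ₑ * traceNorm b T := by
  unfold traceNorm
  rw [← ENNReal.tsum_mul_left]
  refine tsum_congr fun i => ?_
  have h : opAbs (c • T) = ((‖c‖ : ℝ) : ℂ) • opAbs T := by
    have := CFC.abs_smul c T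
    unfold opAbs
    rw [this]
    ext x
    simp
  rw [h, smul_apply, inner_smul_right]
  have : RCLike.re (((‖c‖ : ℝ) : ℂ) * ⟪b i, opAbs T (b i)⟫_ℂ) =
      ‖c‖ * RCLike.re ⟪b i, opAbs T (b i)⟫_ℂ := by simp
  rw [this, ENNReal.ofReal_mul (norm_nonneg _), ofReal_norm]

theorem traceNorm_neg (b : HilbertBasis ι ℂ H) (T : H →L[ℂ] H) :
    traceNorm b (-T) = traceNorm b T := by
  have := traceNorm_smul b (-1) T
  simpa using this

theorem traceNorm_sub_comm (b : HilbertBasis ι ℂ H) (S T : H →L[ℂ] H) :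
    traceNorm b (S - T) = traceNorm b (T - S) := by
  rw [← neg_sub, traceNorm_neg]

/-- `‖V T V*‖₁ ≤ ‖T‖₁` for a contraction `V`. -/
theorem traceNorm_conj_le (b : HilbertBasis ι ℂ H) (V T : H →L[ℂ] H) (hV : ‖V‖ ≤ 1) :
    traceNorm b (V * T * ContinuousLinearMap.adjoint V) ≤ traceNorm b T := by
  refine traceNorm_le_of_forall b _ _ fun K s hK => ?_
  have hV' : ‖ContinuousLinearMap.adjoint V‖ ≤ 1 := by rwa [LinearIsometryEquiv.norm_map]
  have := norm_sum_inner_le_traceNorm b T (ContinuousLinearMap.adjoint V * K)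
    (ContinuousLinearMap.adjoint V)
    ((norm_mul_le _ _).trans (mul_le_one₀ hV' (norm_nonneg _) hK)) hV' s
  refine le_trans (le_of_eq ?_) this
  congr 1
  refine Finset.sum_congr rfl fun i _ => ?_
  exact (ContinuousLinearMap.adjoint_inner_left V _ _).symm

/-- The operator norm is dominated by the trace norm. -/
theorem enorm_inner_le_traceNorm (b : HilbertBasis ι ℂ H) (T : H →L[ℂ] H) {x y : H}
    (hx : ‖x‖ ≤ 1) (hy : ‖y‖ ≤ 1) : ‖⟪x, T y⟫_ℂ‖ₑ ≤ traceNorm b T := by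
  rcases isEmpty_or_nonempty ι with hι | ⟨⟨i⟩⟩
  · have hx0 : x = 0 := by
      have := parseval_enorm b x
      simpa using this
    simp [hx0]
  · have hb : ‖b i‖ = 1 := b.orthonormal.1 i
    have hself : ⟪b i, b i⟫_ℂ = 1 := by
      rw [inner_self_eq_norm_sq_to_K, hb]; simp
    have := norm_sum_inner_le_traceNorm b T (InnerProductSpace.rankOne ℂ x (b i))
      (InnerProductSpace.rankOne ℂ y (b i)) (by simpa [hb] using hx) (by simpa [hb] using hy) {i}
    simpa [hself, hb] using this

theorem eq_zero_of_traceNorm_eq_zero (b : HilbertBasis ι ℂ H) {T : H →L[ℂ] H}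
    (h : traceNorm b T = 0) : T = 0 := by
  have key : ∀ x y : H, ‖x‖ ≤ 1 → ‖y‖ ≤ 1 → ⟪x, T y⟫_ℂ = 0 := fun x y hx hy => by
    have := enorm_inner_le_traceNorm b T hx hy
    rw [h] at this
    simpa using this
  have key1 : ∀ y : H, ‖y‖ ≤ 1 → T y = 0 := fun y hy => by
    by_contra hne
    have hn : ‖T y‖ ≠ 0 := norm_ne_zero_iff.2 hne
    have := key (((‖T y‖⁻¹ : ℝ) : ℂ) • T y) y (by rw [norm_smul]; simp [hn]) hy
    rw [inner_smul_left] at this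
    simp [hne] at this
  ext y
  by_contra hne
  have hy : y ≠ 0 := fun h0 => hne (by simp [h0])
  have hn : ‖y‖ ≠ 0 := norm_ne_zero_iff.2 hy
  have := key1 (((‖y‖⁻¹ : ℝ) : ℂ) • y) (by rw [norm_smul]; simp [hn])
  rw [map_smul] at this
  rcases smul_eq_zero.1 this with h0 | h0
  · simp [hy] at h0
  · exact hne (by simpa using h0)

theorem traceNorm_conj_le_mul (b : HilbertBasis ι ℂ H) (V T : H →L[ℂ] H) :
    traceNorm b (V * T * ContinuousLinearMap.adjoint V) ≤
      ENNReal.ofReal (‖V‖ ^ 2) * traceNorm b T := by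
  rcases eq_or_ne V 0 with rfl | hV
  · simp [traceNorm_zero]
  have hn : ‖V‖ ≠ 0 := norm_ne_zero_iff.2 hV
  set c : ℂ := ((‖V‖ : ℝ) : ℂ) with hc
  have hc0 : c ≠ 0 := by simp [hc, hV]
  set W : H →L[ℂ] H := c⁻¹ • V with hW
  have hVW : V = c • W := by rw [hW, smul_smul, mul_inv_cancel₀ hc0, one_smul]
  have hW1 : ‖W‖ ≤ 1 := by
    rw [hW, norm_smul, norm_inv, hc, Complex.norm_real, Real.norm_of_nonneg (norm_nonneg V),
      inv_mul_cancel₀ hn]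
  have e : V * T * ContinuousLinearMap.adjoint V =
      (c * c) • (W * T * ContinuousLinearMap.adjoint W) := by
    have had : ContinuousLinearMap.adjoint V = c • ContinuousLinearMap.adjoint W := by
      rw [hVW, map_smulₛₗ, hc, Complex.conj_ofReal]
    rw [had, hVW, smul_mul_assoc, smul_mul_assoc, mul_smul_comm, smul_smul]
  have e2 : ‖c * c‖ₑ = ENNReal.ofReal (‖V‖ ^ 2) := by
    rw [← ofReal_norm, norm_mul, hc, Complex.norm_real, Real.norm_of_nonneg (norm_nonneg V), sq]
  rw [e, traceNorm_smul, e2]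
  gcongr
  exact traceNorm_conj_le b W T hW1

theorem traceNorm_of_isPositive (b : HilbertBasis ι ℂ H) {T : H →L[ℂ] H} (hT : T.IsPositive) :
    traceNorm b T = ∑' i, ENNReal.ofReal (RCLike.re ⟪b i, T (b i)⟫_ℂ) := by
  rw [traceNorm, opAbs_of_isPositive hT]

theorem opTrace_of_isPositive (b : HilbertBasis ι ℂ H) {T : H →L[ℂ] H} (hT : T.IsPositive) :
    opTrace b T = (((traceNorm b T).toReal : ℝ) : ℂ) := by
  rw [traceNorm_of_isPositive b hT, ENNReal.tsum_toReal_eq (fun _ => ENNReal.ofReal_ne_top),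
    Complex.ofReal_tsum]
  refine tsum_congr fun i => ?_
  have h0 := hT.inner_nonneg_right (b i)
  rw [ENNReal.toReal_ofReal (hT.re_inner_nonneg_right (b i))]
  exact Complex.ext rfl (by simpa using ((Complex.le_def.1 h0).2).symm)

/-- The density operators on `H`: positive trace class operators of trace one. -/
@[ext]
structure DensityOp (b : HilbertBasis ι ℂ H) where
  /-- The underlying operator. -/
  op : H →L[ℂ] H
  pos : op.IsPositive
  traceClass : traceNorm b op ≠ ⊤
  trace_eq_one : opTrace b op = 1

variable {b : HilbertBasis ι ℂ H}

theorem DensityOp.sub_ne_top (ρ σ : DensityOp b) : traceNorm b (ρ.op - σ.op) ≠ ⊤ := by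
  have := traceNorm_add_le b ρ.op (-σ.op)
  rw [← sub_eq_add_neg, traceNorm_neg] at this
  exact ne_top_of_le_ne_top (ENNReal.add_ne_top.2 ⟨ρ.traceClass, σ.traceClass⟩) this

/-- The set of density operators with the trace-norm distance `‖ρ - σ‖₁`. -/
noncomputable instance : MetricSpace (DensityOp b) where
  dist ρ σ := (traceNorm b (ρ.op - σ.op)).toReal
  dist_self ρ := by simp [traceNorm_zero]
  dist_comm ρ σ := by rw [traceNorm_sub_comm]
  dist_triangle ρ σ τ := by
    rw [← ENNReal.toReal_add (ρ.sub_ne_top σ) (σ.sub_ne_top τ)]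
    refine ENNReal.toReal_mono
      (ENNReal.add_ne_top.2 ⟨ρ.sub_ne_top σ, σ.sub_ne_top τ⟩) ?_
    have := traceNorm_add_le b (ρ.op - σ.op) (σ.op - τ.op)
    rwa [sub_add_sub_cancel] at this
  eq_of_dist_eq_zero {ρ σ} h := by
    rcases (ENNReal.toReal_eq_zero_iff _).1 h with h | h
    · exact DensityOp.ext (sub_eq_zero.1 (eq_zero_of_traceNorm_eq_zero b h))
    · exact absurd h (ρ.sub_ne_top σ)

theorem DensityOp.dist_def (ρ σ : DensityOp b) :
    dist ρ σ = (traceNorm b (ρ.op - σ.op)).toReal := rfl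

/-- Density operators carry the Borel σ-algebra of the trace norm. -/
noncomputable instance : MeasurableSpace (DensityOp b) := borel _

instance : BorelSpace (DensityOp b) := ⟨rfl⟩

/-! ### Quantum trajectories -/

/-- The unnormalized posterior state `V ρ V*`. -/
noncomputable def unnormalized (V : H →L[ℂ] H) (ρ : DensityOp b) : H →L[ℂ] H :=
  V * ρ.op * ContinuousLinearMap.adjoint V

/-- The probability `Tr (V ρ V*)` of the outcome with operator `V`. -/
noncomputable def outcomeProb (V : H →L[ℂ] H) (ρ : DensityOp b) : ℝ :=
  (opTrace b (unnormalized V ρ)).re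

theorem unnormalized_isPositive (V : H →L[ℂ] H) (ρ : DensityOp b) :
    (unnormalized V ρ).IsPositive := ρ.pos.conj_adjoint V

theorem unnormalized_ne_top (V : H →L[ℂ] H) (ρ : DensityOp b) :
    traceNorm b (unnormalized V ρ) ≠ ⊤ :=
  ne_top_of_le_ne_top (ENNReal.mul_ne_top ENNReal.ofReal_ne_top ρ.traceClass)
    (traceNorm_conj_le_mul b V ρ.op)

theorem outcomeProb_eq (V : H →L[ℂ] H) (ρ : DensityOp b) :
    outcomeProb V ρ = (traceNorm b (unnormalized V ρ)).toReal := by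
  rw [outcomeProb, opTrace_of_isPositive b (unnormalized_isPositive V ρ), Complex.ofReal_re]

/-- The posterior state `V ρ V* / Tr (V ρ V*)`. When the outcome has probability zero the value is
irrelevant and set to `ρ`. -/
noncomputable def postState (V : H →L[ℂ] H) (ρ : DensityOp b) : DensityOp b :=
  open Classical in
  if h : outcomeProb V ρ = 0 then ρ else
  { op := ((outcomeProb V ρ)⁻¹ : ℂ) • unnormalized V ρ
    pos := (unnormalized_isPositive V ρ).smul_of_nonneg (by
      rw [outcomeProb_eq, ← Complex.ofReal_inv]
      exact_mod_cast inv_nonneg.2 ENNReal.toReal_nonneg)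
    traceClass := by
      rw [traceNorm_smul]
      exact ENNReal.mul_ne_top enorm_ne_top (unnormalized_ne_top V ρ)
    trace_eq_one := by
      have h1 : opTrace b (unnormalized V ρ) = (outcomeProb V ρ : ℂ) := by
        rw [opTrace_of_isPositive b (unnormalized_isPositive V ρ), outcomeProb_eq]
      have h2 : opTrace b (((outcomeProb V ρ)⁻¹ : ℂ) • unnormalized V ρ) =
          ((outcomeProb V ρ)⁻¹ : ℂ) * opTrace b (unnormalized V ρ) := by
        unfold opTrace
        rw [← tsum_mul_left]
        exact tsum_congr fun i => by rw [smul_apply, inner_smul_right]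
      rw [h2, h1]
      exact inv_mul_cancel₀ (by exact_mod_cast h) }

theorem postState_op (V : H →L[ℂ] H) (ρ : DensityOp b) (h : outcomeProb V ρ ≠ 0) :
    (postState V ρ).op = ((outcomeProb V ρ)⁻¹ : ℂ) • unnormalized V ρ := by
  simp [postState, h]

theorem traceNorm_unnormalized_sub_le (V : H →L[ℂ] H) (ρ σ : DensityOp b) :
    traceNorm b (unnormalized V ρ - unnormalized V σ) ≤
      ENNReal.ofReal (‖V‖ ^ 2) * traceNorm b (ρ.op - σ.op) := by
  have := traceNorm_conj_le_mul b V (ρ.op - σ.op)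
  rwa [mul_sub, sub_mul] at this

theorem unnormalized_sub_ne_top (V : H →L[ℂ] H) (ρ σ : DensityOp b) :
    traceNorm b (unnormalized V ρ - unnormalized V σ) ≠ ⊤ :=
  ne_top_of_le_ne_top (ENNReal.mul_ne_top ENNReal.ofReal_ne_top (ρ.sub_ne_top σ))
    (traceNorm_unnormalized_sub_le V ρ σ)

theorem unnormalized_dist_le (V : H →L[ℂ] H) (ρ σ : DensityOp b) :
    (traceNorm b (unnormalized V ρ - unnormalized V σ)).toReal ≤ ‖V‖ ^ 2 * dist ρ σ := by
  have := ENNReal.toReal_mono (ENNReal.mul_ne_top ENNReal.ofReal_ne_top (ρ.sub_ne_top σ))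
    (traceNorm_unnormalized_sub_le V ρ σ)
  rwa [ENNReal.toReal_mul, ENNReal.toReal_ofReal (by positivity)] at this

theorem outcomeProb_sub_le (V : H →L[ℂ] H) (ρ σ : DensityOp b) :
    outcomeProb V ρ - outcomeProb V σ ≤ ‖V‖ ^ 2 * dist ρ σ := by
  refine le_trans ?_ (unnormalized_dist_le V ρ σ)
  rw [outcomeProb_eq, outcomeProb_eq, sub_le_iff_le_add,
    ← ENNReal.toReal_add (unnormalized_sub_ne_top V ρ σ) (unnormalized_ne_top V σ)]
  refine ENNReal.toReal_mono
    (ENNReal.add_ne_top.2 ⟨unnormalized_sub_ne_top V ρ σ, unnormalized_ne_top V σ⟩) ?_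
  have := traceNorm_add_le b (unnormalized V ρ - unnormalized V σ) (unnormalized V σ)
  rwa [sub_add_cancel] at this

theorem continuous_outcomeProb (V : H →L[ℂ] H) :
    Continuous (outcomeProb V : DensityOp b → ℝ) := by
  refine (LipschitzWith.of_dist_le_mul (K := ⟨‖V‖ ^ 2, by positivity⟩) fun ρ σ => ?_).continuous
  rw [Real.dist_eq, abs_le]
  have h1 := outcomeProb_sub_le V ρ σ
  have h2 := outcomeProb_sub_le V σ ρ
  rw [dist_comm σ ρ] at h2
  constructor
  · change -(‖V‖ ^ 2 * dist ρ σ) ≤ _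
    linarith
  · exact h1

theorem dist_postState_le (V : H →L[ℂ] H) (ρ σ : DensityOp b) (hρ : outcomeProb V ρ ≠ 0)
    (hσ : outcomeProb V σ ≠ 0) :
    dist (postState V ρ) (postState V σ) ≤
      |(outcomeProb V ρ)⁻¹| * (‖V‖ ^ 2 * dist ρ σ) +
        |(outcomeProb V ρ)⁻¹ - (outcomeProb V σ)⁻¹| * outcomeProb V σ := by
  set p := outcomeProb V ρ
  set q := outcomeProb V σ with hq
  have e : (postState V ρ).op - (postState V σ).op =
      ((p⁻¹ : ℝ) : ℂ) • (unnormalized V ρ - unnormalized V σ) +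
        ((p⁻¹ - q⁻¹ : ℝ) : ℂ) • unnormalized V σ := by
    rw [postState_op V ρ hρ, postState_op V σ hσ]
    push_cast
    rw [smul_sub, sub_smul]
    abel
  rw [DensityOp.dist_def, e]
  have h := traceNorm_add_le b (((p⁻¹ : ℝ) : ℂ) • (unnormalized V ρ - unnormalized V σ))
    (((p⁻¹ - q⁻¹ : ℝ) : ℂ) • unnormalized V σ)
  rw [traceNorm_smul, traceNorm_smul] at h
  have t1 : ‖((p⁻¹ : ℝ) : ℂ)‖ₑ * traceNorm b (unnormalized V ρ - unnormalized V σ) ≠ ⊤ :=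
    ENNReal.mul_ne_top enorm_ne_top (unnormalized_sub_ne_top V ρ σ)
  have t2 : ‖((p⁻¹ - q⁻¹ : ℝ) : ℂ)‖ₑ * traceNorm b (unnormalized V σ) ≠ ⊤ :=
    ENNReal.mul_ne_top enorm_ne_top (unnormalized_ne_top V σ)
  refine (ENNReal.toReal_mono (ENNReal.add_ne_top.2 ⟨t1, t2⟩) h).trans ?_
  rw [ENNReal.toReal_add t1 t2, ENNReal.toReal_mul, ENNReal.toReal_mul, toReal_enorm, toReal_enorm,
    Complex.norm_real, Complex.norm_real, ← outcomeProb_eq, Real.norm_eq_abs, Real.norm_eq_abs]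
  gcongr
  exact unnormalized_dist_le V ρ σ

theorem measurable_postState (V : H →L[ℂ] H) :
    Measurable (postState V : DensityOp b → DensityOp b) := by
  classical
  set s : Set (DensityOp b) := {ρ | outcomeProb V ρ = 0} with hs
  have hsm : MeasurableSet s :=
    (isClosed_singleton.preimage (continuous_outcomeProb V) : IsClosed s).measurableSet
  have hc : ContinuousOn (postState V : DensityOp b → DensityOp b) sᶜ := by
    intro σ hσ
    have hσ' : outcomeProb V σ ≠ 0 := hσ
    refine ContinuousAt.continuousWithinAt ?_
    rw [ContinuousAt, tendsto_iff_dist_tendsto_zero]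
    have hp : Tendsto (fun ρ : DensityOp b => outcomeProb V ρ) (𝓝 σ) (𝓝 (outcomeProb V σ)) :=
      (continuous_outcomeProb V).tendsto σ
    have hpi := hp.inv₀ hσ'
    have hd : Tendsto (fun ρ : DensityOp b => dist ρ σ) (𝓝 σ) (𝓝 0) :=
      tendsto_iff_dist_tendsto_zero.1 tendsto_id
    have hlim : Tendsto (fun ρ : DensityOp b =>
        |(outcomeProb V ρ)⁻¹| * (‖V‖ ^ 2 * dist ρ σ) +
        |(outcomeProb V ρ)⁻¹ - (outcomeProb V σ)⁻¹| * outcomeProb V σ) (𝓝 σ) (𝓝 0) := by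
      have := (hpi.abs.mul (hd.const_mul (‖V‖ ^ 2))).add
        (((hpi.sub_const (outcomeProb V σ)⁻¹).abs).mul_const (outcomeProb V σ))
      simpa using this
    refine squeeze_zero' (Eventually.of_forall fun _ => dist_nonneg) ?_ hlim
    filter_upwards [hp.eventually_ne hσ'] with ρ hρ
    exact dist_postState_le V ρ σ hρ hσ'
  have := ContinuousOn.measurable_piecewise (f := id) continuousOn_id hc hsm
  convert this using 1
  funext ρ
  by_cases h : ρ ∈ s
  · have h' : outcomeProb V ρ = 0 := h
    simp [Set.piecewise_eq_of_mem _ _ _ h, postState, h']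
  · simp [Set.piecewise_eq_of_notMem _ _ _ h]

/-- The Markov kernel of the quantum trajectory with measurement operators `V y`, `y ∈ R`:
`Π(ρ, S) = ∑_y 1_S(V_y ρ V_y* / Tr(V_y ρ V_y*)) Tr(V_y ρ V_y*)`. -/
noncomputable def trajectoryKernel (b : HilbertBasis ι ℂ H) {R : Type*} [Fintype R]
    (V : R → H →L[ℂ] H) : Kernel (DensityOp b) (DensityOp b) where
  toFun ρ := ∑ y, ENNReal.ofReal (outcomeProb (V y) ρ) • Measure.dirac (postState (V y) ρ)
  measurable' := by
    refine Measure.measurable_of_measurable_coe _ fun S hS => ?_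
    simp only [Measure.finsetSum_apply, Measure.smul_apply, smul_eq_mul]
    refine Finset.measurable_fun_sum _ fun y _ => Measurable.mul ?_ ?_
    · exact (continuous_outcomeProb (V y)).measurable.ennreal_ofReal
    · exact (Measure.measurable_coe hS).comp
        (Measure.measurable_dirac.comp (measurable_postState (V y)))

/-- The Wasserstein distance of order one between probability measures on the (bounded) metric
space of density operators, in its Kantorovich-Rubinstein form. -/
noncomputable def wasserstein1 (μ ν : Measure (DensityOp b)) : ℝ≥0∞ :=
  ⨆ (f : DensityOp b → ℝ) (_ : LipschitzWith 1 f), ENNReal.ofReal (∫ ρ, f ρ ∂μ - ∫ ρ, f ρ ∂ν)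

end TraceClass

/-! ### The one-atom maser -/

/-- The bosonic Fock space over `ℂ`, realized as `ℓ²(ℕ)` through the photon number. -/
noncomputable abbrev FockSpace : Type := lp (fun _ : ℕ => ℂ) 2

/-- The Fock basis `|n⟩`, `n ∈ ℕ`. -/
noncomputable def fockBasis : HilbertBasis ℕ ℂ FockSpace :=
  HilbertBasis.ofRepr (LinearIsometryEquiv.refl ℂ FockSpace)

/-- The annihilation operator, acting on sequences of coefficients in the Fock basis:
`a |n⟩ = √n |n - 1⟩`. -/
noncomputable def annihilation : (ℕ → ℂ) →ₗ[ℂ] (ℕ → ℂ) where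
  toFun ψ n := (√((n : ℝ) + 1) : ℂ) * ψ (n + 1)
  map_add' _ _ := by ext; simp [mul_add]
  map_smul' _ _ := by ext; simp [mul_left_comm]

/-- The creation operator, acting on sequences of coefficients in the Fock basis:
`a* |n⟩ = √(n + 1) |n + 1⟩`. The coefficient at `0` vanishes because of the factor `√0`. -/
noncomputable def creation : (ℕ → ℂ) →ₗ[ℂ] (ℕ → ℂ) where
  toFun ψ n := (√(n : ℝ) : ℂ) * ψ (n - 1)
  map_add' _ _ := by ext; simp [mul_add]
  map_smul' _ _ := by ext; simp [mul_left_comm]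

/-- The function `f(N)` of the number operator, `f(N) |n⟩ = f(n) |n⟩`, acting on sequences of
coefficients. -/
noncomputable def ofNumber (f : ℕ → ℂ) : (ℕ → ℂ) →ₗ[ℂ] (ℕ → ℂ) where
  toFun ψ n := f n * ψ n
  map_add' _ _ := by ext; simp [mul_add]
  map_smul' _ _ := by ext; simp [mul_left_comm]

/-- The bounded operator on the Fock space given by a linear map on sequences of coefficients (and
`0` if the latter does not restrict to a bounded operator). -/
noncomputable def toBounded (T : (ℕ → ℂ) →ₗ[ℂ] (ℕ → ℂ)) : FockSpace →L[ℂ] FockSpace :=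
  open Classical in
  if h : ∃ B : FockSpace →L[ℂ] FockSpace, ∀ (ψ : FockSpace) (n : ℕ), B ψ n = T ψ n
  then h.choose else 0

/-- A criterion for `toBounded` to be the intended operator. -/
theorem toBounded_apply (T : (ℕ → ℂ) →ₗ[ℂ] (ℕ → ℂ)) (w : ℕ → ℂ) (g : ℕ → ℕ) {C : ℝ}
    (hw : ∀ n, ‖w n‖ ≤ C) (hg : Set.InjOn g {n | w n ≠ 0})
    (hT : ∀ ψ n, T ψ n = w n * ψ (g n)) (ψ : FockSpace) (n : ℕ) : toBounded T ψ n = T ψ n := by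
  have hC : 0 ≤ C := (norm_nonneg _).trans (hw 0)
  have h2 : (2 : ℝ≥0∞).toReal = ((2 : ℕ) : ℝ) := by simp
  have hbd : ∀ (ψ : FockSpace) (s : Finset ℕ),
      ∑ n ∈ s, ‖T ψ n‖ ^ (2 : ℝ≥0∞).toReal ≤ (C * ‖ψ‖) ^ (2 : ℝ≥0∞).toReal := by
    intro ψ s
    simp only [h2, Real.rpow_natCast, hT, norm_mul, mul_pow]
    have hψ : ∀ t : Finset ℕ, ∑ i ∈ t, ‖ψ i‖ ^ 2 ≤ ‖ψ‖ ^ 2 := fun t => by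
      have := lp.sum_rpow_le_norm_rpow (p := 2) (by simp) ψ t
      simpa [h2] using this
    classical
    calc ∑ n ∈ s, ‖w n‖ ^ 2 * ‖ψ (g n)‖ ^ 2
        = ∑ n ∈ s with w n ≠ 0, ‖w n‖ ^ 2 * ‖ψ (g n)‖ ^ 2 := by
          rw [Finset.sum_filter]
          refine Finset.sum_congr rfl fun n _ => ?_
          split_ifs with h
          · rfl
          · push Not at h
            simp [h]
      _ ≤ ∑ n ∈ s with w n ≠ 0, C ^ 2 * ‖ψ (g n)‖ ^ 2 := by
          gcongr with n
          exact hw n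
      _ = C ^ 2 * ∑ i ∈ (s.filter fun n => w n ≠ 0).image g, ‖ψ i‖ ^ 2 := by
          rw [Finset.mul_sum, Finset.sum_image]
          intro x hx y hy
          exact hg (by simpa using (Finset.mem_filter.1 hx).2)
            (by simpa using (Finset.mem_filter.1 hy).2)
      _ ≤ C ^ 2 * ‖ψ‖ ^ 2 := by gcongr; exact hψ _
  have hmem : ∀ ψ : FockSpace, Memℓp (T ψ) 2 := fun ψ => memℓp_gen' (hbd ψ)
  let L : FockSpace →ₗ[ℂ] FockSpace :=
    { toFun := fun ψ => ⟨T ψ, hmem ψ⟩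
      map_add' := fun ψ φ => by ext n; exact congrFun (map_add T (ψ : ℕ → ℂ) φ) n
      map_smul' := fun c ψ => by ext n; exact congrFun (map_smul T c (ψ : ℕ → ℂ)) n }
  have hL : ∀ ψ, ‖L ψ‖ ≤ C * ‖ψ‖ := fun ψ =>
    lp.norm_le_of_forall_sum_le (by simp) (by positivity) (hbd ψ)
  have hex : ∃ B : FockSpace →L[ℂ] FockSpace, ∀ (ψ : FockSpace) (n : ℕ), B ψ n = T ψ n :=
    ⟨L.mkContinuous C hL, fun ψ n => rfl⟩
  rw [toBounded, dif_pos hex]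
  exact hex.choose_spec ψ n

/-- The parameters of the one-atom maser: field frequency `ε₀`, Bohr frequency `ε` of the atoms,
coupling constant `lam`, interaction time `τ`, inverse temperature `β` of the atoms. -/
structure MaserParams where
  /-- Frequency of the field mode. -/
  ε₀ : ℝ
  /-- Bohr frequency of the atoms. -/
  ε : ℝ
  /-- Coupling constant. -/
  lam : ℝ
  /-- Interaction time. -/
  τ : ℝ
  /-- Inverse temperature of the atoms. -/
  β : ℝ

namespace MaserParams

variable (p : MaserParams)

/-- The dimensionless detuning parameter `η = (Δτ / 2π)²`, with `Δ = ε - ε₀`. -/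
noncomputable def η : ℝ := ((p.ε - p.ε₀) * p.τ / (2 * Real.pi)) ^ 2

/-- The dimensionless coupling constant `ξ = (λτ / π)²`. -/
noncomputable def ξ : ℝ := (p.lam * p.τ / Real.pi) ^ 2

/-- There is no Rabi resonance, i.e. no positive integer `n` such that `ξ n + η` is the square of a
positive integer. -/
def NonResonant : Prop :=
  ¬ ∃ n k : ℕ, 0 < n ∧ 0 < k ∧ p.ξ * n + p.η = (k : ℝ) ^ 2

/-- The probability that the atom enters the cavity in its ground state (`false`) or in its excited
state (`true`). -/
noncomputable def atomProb : Bool → ℝ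
  | false => 1 / (1 + Real.exp (-p.β * p.ε))
  | true => Real.exp (-p.β * p.ε) / (1 + Real.exp (-p.β * p.ε))

/-- `C(n) = cos(π√(ξn+η)) + i δ sin(π√(ξn+η)) / √(ξn+η)`, where `δ` is a square root of `η`. If
`ξn+η = 0` then `δ = 0` and the second term vanishes. -/
noncomputable def cosFn (δ : ℝ) (n : ℕ) : ℂ :=
  (Real.cos (Real.pi * √(p.ξ * n + p.η)) : ℂ) +
    Complex.I * ((δ * (Real.sin (Real.pi * √(p.ξ * n + p.η)) / √(p.ξ * n + p.η)) : ℝ) : ℂ)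

/-- `S(n) = √ξ sin(π√(ξn+η)) / √(ξn+η)`. Only the values at `n ≥ 1` are used. -/
noncomputable def sinFn (n : ℕ) : ℂ :=
  ((√p.ξ * (Real.sin (Real.pi * √(p.ξ * n + p.η)) / √(p.ξ * n + p.η)) : ℝ) : ℂ)

/-- The free evolution `exp(-iτωN)`. -/
noncomputable def phase (ω : ℝ) : (ℕ → ℂ) →ₗ[ℂ] (ℕ → ℂ) :=
  ofNumber fun n => Complex.exp (-Complex.I * p.τ * ω * n)

/-- The Kraus operators `V_{σσ'}` as maps on sequences of coefficients, where `false` stands for `-`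
and `true` for `+`. -/
noncomputable def krausSeq (ω δ : ℝ) : Bool × Bool → (ℕ → ℂ) →ₗ[ℂ] (ℕ → ℂ)
  | (false, false) => (√(p.atomProb false) : ℂ) • (p.phase ω ∘ₗ ofNumber fun n => p.cosFn δ n)
  | (false, true) =>
      (√(p.atomProb false) : ℂ) •
        (p.phase ω ∘ₗ (ofNumber fun n => p.sinFn (n + 1)) ∘ₗ annihilation)
  | (true, false) =>
      (√(p.atomProb true) : ℂ) • (p.phase ω ∘ₗ (ofNumber fun n => p.sinFn n) ∘ₗ creation)
  | (true, true) =>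
      (√(p.atomProb true) : ℂ) •
        (p.phase ω ∘ₗ ofNumber fun n => (starRingEnd ℂ) (p.cosFn δ (n + 1)))

/-- The Kraus operators `V_{σσ'}` on the Fock space. The printed closed formulas correspond to
`ω = ε` and `δ = √η`. Reducing the Jaynes-Cummings propagator gives, up to a scalar phase in each
`V_{σσ'}`, the values `ω = ε₀` and `δ = Δτ / 2π`, where `δ ^ 2 = η` as well. -/
noncomputable def kraus (ω δ : ℝ) (y : Bool × Bool) : FockSpace →L[ℂ] FockSpace :=
  toBounded (p.krausSeq ω δ y)

theorem atomProb_sqrt_le (σ : Bool) : √(p.atomProb σ) ≤ 1 := by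
  rw [Real.sqrt_le_one]
  have := Real.exp_pos (-p.β * p.ε)
  cases σ
  · exact (div_le_one (by positivity)).2 (by linarith)
  · exact (div_le_one (by positivity)).2 (by linarith)

theorem arg_nonneg (n : ℕ) : 0 ≤ p.ξ * n + p.η := by
  unfold ξ η
  positivity

theorem norm_cosFn_le (δ : ℝ) (n : ℕ) : ‖p.cosFn δ n‖ ≤ 1 + |δ| * Real.pi := by
  set y := √(p.ξ * n + p.η)
  have hy : 0 ≤ y := Real.sqrt_nonneg _
  have h1 : |Real.sin (Real.pi * y) / y| ≤ Real.pi := by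
    rcases hy.eq_or_lt with h | h
    · rw [← h]; simp [Real.pi_pos.le]
    · rw [abs_div, abs_of_pos h, div_le_iff₀ h]
      refine Real.abs_sin_le_abs.trans (le_of_eq ?_)
      rw [abs_of_nonneg (mul_nonneg Real.pi_pos.le hy)]
  unfold cosFn
  refine (norm_add_le _ _).trans ?_
  rw [norm_mul, Complex.norm_I, one_mul, Complex.norm_real, Complex.norm_real, norm_mul,
    Real.norm_eq_abs, Real.norm_eq_abs, Real.norm_eq_abs]
  have h2 := Real.abs_cos_le_one (Real.pi * y)
  have h3 : |δ| * |Real.sin (Real.pi * y) / y| ≤ |δ| * Real.pi := by gcongr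
  exact add_le_add h2 h3

theorem norm_sinFn_mul_le (n : ℕ) : ‖p.sinFn n * (√(n : ℝ) : ℂ)‖ ≤ 1 := by
  have h0 := p.arg_nonneg n
  set x := p.ξ * n + p.η with hx
  have hξ : 0 ≤ p.ξ := by unfold ξ; positivity
  have hη : 0 ≤ p.η := by unfold η; positivity
  have h1 : √p.ξ * √(n : ℝ) ≤ √x := by
    rw [← Real.sqrt_mul hξ]
    exact Real.sqrt_le_sqrt (by linarith)
  unfold sinFn
  rw [← Complex.ofReal_mul, Complex.norm_real, Real.norm_eq_abs, ← hx]
  rcases (Real.sqrt_nonneg x).eq_or_lt with h | h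
  · rw [← h]; simp
  have e : √p.ξ * (Real.sin (Real.pi * √x) / √x) * √(n : ℝ) =
      (√p.ξ * √(n : ℝ)) / √x * Real.sin (Real.pi * √x) := by ring
  rw [e, abs_mul]
  refine mul_le_one₀ ?_ (abs_nonneg _) (Real.abs_sin_le_one _)
  rw [abs_of_nonneg (by positivity), div_le_one h]
  exact h1

theorem norm_phase (ω : ℝ) (n : ℕ) : ‖Complex.exp (-Complex.I * p.τ * ω * n)‖ = 1 := by
  rw [Complex.norm_exp]
  simp

/-- The Kraus operators are indeed given by the formulas for `krausSeq`. -/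
theorem kraus_apply (ω δ : ℝ) (y : Bool × Bool) (ψ : FockSpace) (n : ℕ) :
    p.kraus ω δ y ψ n = p.krausSeq ω δ y ψ n := by
  have hC : 0 ≤ |δ| * Real.pi := mul_nonneg (abs_nonneg _) Real.pi_pos.le
  have hbound : ∀ (σ : Bool) (n : ℕ) (z : ℂ) (C : ℝ), ‖z‖ ≤ C →
      ‖(√(p.atomProb σ) : ℂ) * (Complex.exp (-Complex.I * p.τ * ω * n) * z)‖ ≤ C := by
    intro σ n z C hz
    rw [norm_mul, norm_mul, norm_phase, one_mul, Complex.norm_real,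
      Real.norm_of_nonneg (Real.sqrt_nonneg _)]
    have := p.atomProb_sqrt_le σ
    have h1 : √(p.atomProb σ) * ‖z‖ ≤ 1 * ‖z‖ := by gcongr
    linarith
  match y with
  | (false, false) =>
    exact toBounded_apply _
      (fun n => (√(p.atomProb false) : ℂ) *
        (Complex.exp (-Complex.I * p.τ * ω * n) * p.cosFn δ n)) id
      (fun n => hbound _ n _ _ (p.norm_cosFn_le δ n)) Function.injective_id.injOn
      (fun ψ n => by simp [krausSeq, phase, ofNumber, mul_assoc]) ψ n
  | (false, true) =>
    exact toBounded_apply _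
      (fun n => (√(p.atomProb false) : ℂ) *
        (Complex.exp (-Complex.I * p.τ * ω * n) *
          (p.sinFn (n + 1) * (√((n + 1 : ℕ) : ℝ) : ℂ)))) (fun n => n + 1)
      (fun n => hbound _ n _ _ (p.norm_sinFn_mul_le (n + 1))) (add_left_injective 1).injOn
      (fun ψ n => by simp [krausSeq, phase, ofNumber, annihilation, mul_assoc]) ψ n
  | (true, false) =>
    refine toBounded_apply _
      (fun n => (√(p.atomProb true) : ℂ) *
        (Complex.exp (-Complex.I * p.τ * ω * n) * (p.sinFn n * (√(n : ℝ) : ℂ)))) (fun n => n - 1)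
      (fun n => hbound _ n _ _ (p.norm_sinFn_mul_le n)) ?_
      (fun ψ n => by simp [krausSeq, phase, ofNumber, creation, mul_assoc]) ψ n
    have h0 : ∀ n : ℕ, (√(p.atomProb true) : ℂ) *
        (Complex.exp (-Complex.I * p.τ * ω * n) * (p.sinFn n * (√(n : ℝ) : ℂ))) ≠ 0 → n ≠ 0 := by
      rintro n hn rfl
      simp at hn
    intro m hm n hn hmn
    have := h0 m hm
    have := h0 n hn
    have : m - 1 = n - 1 := hmn
    omega
  | (true, true) =>
    exact toBounded_apply _
      (fun n => (√(p.atomProb true) : ℂ) *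
        (Complex.exp (-Complex.I * p.τ * ω * n) * (starRingEnd ℂ) (p.cosFn δ (n + 1)))) id
      (fun n => hbound _ n _ _ (by rw [RCLike.norm_conj]; exact p.norm_cosFn_le δ (n + 1)))
      Function.injective_id.injOn
      (fun ψ n => by simp [krausSeq, phase, ofNumber, mul_assoc]) ψ n

/-- The Markov kernel `Π` of the quantum trajectory of the one-atom maser. -/
noncomputable def kernel (ω δ : ℝ) : Kernel (DensityOp fockBasis) (DensityOp fockBasis) :=
  trajectoryKernel fockBasis (p.kraus ω δ)

/-- The operator `exp(-βεN)`. -/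
noncomputable def boltzmann : FockSpace →L[ℂ] FockSpace :=
  toBounded (ofNumber fun n => (Real.exp (-p.β * p.ε * n) : ℂ))

theorem boltzmann_apply (h : 0 ≤ p.β * p.ε) (ψ : FockSpace) (n : ℕ) :
    p.boltzmann ψ n = (Real.exp (-p.β * p.ε * n) : ℂ) * ψ n := by
  refine toBounded_apply _ (fun n => (Real.exp (-p.β * p.ε * n) : ℂ)) id (C := 1) (fun n => ?_)
    Function.injective_id.injOn (fun ψ n => rfl) ψ n
  rw [Complex.norm_real, Real.norm_of_nonneg (Real.exp_pos _).le, Real.exp_le_one_iff]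
  have : 0 ≤ p.β * p.ε * n := by positivity
  linarith

/-- The Gibbs state `ρ_inv = exp(-βεN) / Tr exp(-βεN)`. -/
noncomputable def rhoInv : FockSpace →L[ℂ] FockSpace :=
  (opTrace fockBasis p.boltzmann)⁻¹ • p.boltzmann

end MaserParams

/-- The pure state `|x⟩⟨x|` of a unit vector. -/
noncomputable def pureState {ι H : Type*} [NormedAddCommGroup H] [InnerProductSpace ℂ H]
    [CompleteSpace H] (b : HilbertBasis ι ℂ H) (x : H) (hx : ‖x‖ = 1) : DensityOp b :=
  have hpos : (InnerProductSpace.rankOne ℂ x x).IsPositive := by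
    have := ContinuousLinearMap.isPositive_one (𝕜 := ℂ) (E := H)
    exact InnerProductSpace.isPositive_rankOne_self x
  have htr : opTrace b (InnerProductSpace.rankOne ℂ x x) = 1 := by
    have h := b.tsum_inner_mul_inner x x
    rw [inner_self_eq_norm_sq_to_K, hx] at h
    simp only [opTrace, InnerProductSpace.rankOne_apply, inner_smul_right]
    simpa using h
  { op := InnerProductSpace.rankOne ℂ x x
    pos := hpos
    traceClass := by
      intro htop
      rw [opTrace_of_isPositive b hpos, htop] at htr
      simp at htr
    trace_eq_one := htr }

/-- The Fock state `|n⟩⟨n|`. -/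
noncomputable def fockState (n : ℕ) : DensityOp fockBasis :=
  pureState fockBasis (fockBasis n) (fockBasis.orthonormal.1 n)

/-- The mixture of Fock states `ν_inv = ∑ₙ ⟨n, ρ_inv n⟩ δ_{|n⟩⟨n|}`. -/
noncomputable def MaserParams.nuInv (p : MaserParams) : Measure (DensityOp fockBasis) :=
  Measure.sum fun n =>
    ENNReal.ofReal (RCLike.re ⟪fockBasis n, p.rhoInv (fockBasis n)⟫_ℂ) •
      Measure.dirac (fockState n)

/-!
Each Kraus operator maps the Fock vector `|n⟩` to a multiple of another Fock vector
(`IsWeightedShift`), so the label `n` of a Fock state performs a classical birth-death chain, with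
death rates `b n = p_at(-) s n` and birth rates `x b (n + 1)`, where `x = exp (-βε)` and `s n` is the
Rabi probability. Non-resonance means `s n > 0` for `n ≥ 1`. The theorem follows from two facts.

*Classical mixing.* The geometric law `(1 - x) xⁿ` is stationary by detailed balance. The discrete
gradient intertwines the transition operator with the operator `gradOp`, which is positive because
`s n ≤ 1`. The explicit function `h n = (n + 1) / ((1 - x) b (n + 1))` satisfies `gradOp h = h - 1`,
so the iterates `gradOpᵗ 1` are summable in `t` and tend to zero: gradients of bounded functions die
out, and the chain converges to the geometric law
(`IsDeathRate.exists_abs_chainOp_pow_sub_le`). No lower bound on the rates is needed, although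
`s n` may come arbitrarily close to `0`.

*Purification.* The record of outcomes determines all changes of the photon number. The chain started
from the larger of two photon numbers `n < n + d` goes below `d` sooner or later, and the record is
then impossible for the smaller one. Hence the Hellinger affinity of the two laws of the record
tends to `0` (`IsOutcomeAmplitude.tendsto_affinity`), and the posterior law of the initial label
concentrates on one point. As `‖ρ - |k⟩⟨k|‖₁ ≤ 4 √(1 - ρ_kk)` (`DensityOp.dist_basisState_le`), the
posterior state is close to a random Fock state, which evolves by the classical chain
(`abs_integral_trajectoryKernel_le`).

The resulting bounds are uniform over Lipschitz functions and depend on the initial state only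
through the mass of its populations outside a finite set. Integration over `ν` gives convergence in
`W₁`, and weak convergence is tested on Lipschitz functions.
-/

/-! ### Populations of a density operator and the distance to a basis state -/

section Population

variable {ι : Type*} {H : Type*} [NormedAddCommGroup H] [InnerProductSpace ℂ H] [CompleteSpace H]

theorem hasSum_re_inner_of_isPositive (b : HilbertBasis ι ℂ H) {T : H →L[ℂ] H}
    (hT : T.IsPositive) (htop : traceNorm b T ≠ ⊤) :
    HasSum (fun i => RCLike.re ⟪b i, T (b i)⟫_ℂ) (traceNorm b T).toReal := by
  rw [traceNorm_of_isPositive b hT] at htop ⊢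
  have h := ENNReal.hasSum_toReal htop
  rw [← ENNReal.tsum_toReal_eq (fun _ => ENNReal.ofReal_ne_top)] at h
  exact h.congr_fun fun i => (ENNReal.toReal_ofReal (hT.re_inner_nonneg_right (b i))).symm

/-- The Cauchy-Schwarz inequality for the form `⟪x, P y⟫` of a positive operator. -/
theorem norm_inner_sq_le_of_isPositive {P : H →L[ℂ] H} (hP : P.IsPositive) (x y : H) :
    ‖⟪x, P y⟫_ℂ‖ ^ 2 ≤ RCLike.re ⟪x, P x⟫_ℂ * RCLike.re ⟪y, P y⟫_ℂ := by
  obtain ⟨A, rfl, hs⟩ := exists_sqrt hP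
  have e : ∀ x y, ⟪x, (A * A) y⟫_ℂ = ⟪A x, A y⟫_ℂ := fun x y => (hs x (A y)).symm
  rw [e, e, e, inner_self_eq_norm_sq, inner_self_eq_norm_sq, ← mul_pow]
  gcongr
  exact norm_inner_le_norm _ _

theorem traceNorm_rankOne_le (b : HilbertBasis ι ℂ H) (x y : H) :
    traceNorm b (InnerProductSpace.rankOne ℂ x y) ≤ ENNReal.ofReal (‖x‖ * ‖y‖) := by
  refine traceNorm_le_of_forall b _ _ fun K s hK => ?_
  rw [← ofReal_norm]
  refine ENNReal.ofReal_le_ofReal ?_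
  set z := ContinuousLinearMap.adjoint K x
  have hz : ‖z‖ ≤ ‖x‖ := by
    refine ((ContinuousLinearMap.adjoint K).le_opNorm x).trans ?_
    rw [LinearIsometryEquiv.norm_map]
    exact mul_le_of_le_one_left (norm_nonneg _) hK
  have hterm : ∀ i, ⟪K (b i), InnerProductSpace.rankOne ℂ x y (b i)⟫_ℂ =
      ⟪y, b i⟫_ℂ * ⟪b i, z⟫_ℂ := fun i => by
    rw [InnerProductSpace.rankOne_apply, inner_smul_right, ContinuousLinearMap.adjoint_inner_right]
  simp only [hterm]
  have hB : ∀ v : H, ∑ i ∈ s, ‖⟪b i, v⟫_ℂ‖ ^ 2 ≤ ‖v‖ ^ 2 := fun v =>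
    b.orthonormal.sum_inner_products_le v
  have h1 : ‖∑ i ∈ s, ⟪y, b i⟫_ℂ * ⟪b i, z⟫_ℂ‖ ≤ ∑ i ∈ s, ‖⟪b i, y⟫_ℂ‖ * ‖⟪b i, z⟫_ℂ‖ := by
    refine (norm_sum_le _ _).trans (le_of_eq (Finset.sum_congr rfl fun i _ => ?_))
    rw [norm_mul, norm_inner_symm]
  refine h1.trans (le_of_sq_le_sq ?_ (by positivity))
  calc (∑ i ∈ s, ‖⟪b i, y⟫_ℂ‖ * ‖⟪b i, z⟫_ℂ‖) ^ 2
      ≤ (∑ i ∈ s, ‖⟪b i, y⟫_ℂ‖ ^ 2) * ∑ i ∈ s, ‖⟪b i, z⟫_ℂ‖ ^ 2 :=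
        Finset.sum_mul_sq_le_sq_mul_sq _ _ _
    _ ≤ ‖y‖ ^ 2 * ‖z‖ ^ 2 := by
        gcongr
        · exact hB y
        · exact hB z
    _ ≤ ‖y‖ ^ 2 * ‖x‖ ^ 2 := by gcongr
    _ = (‖x‖ * ‖y‖) ^ 2 := by ring

variable {b : HilbertBasis ι ℂ H}

/-- The population `⟨bᵢ, ρ bᵢ⟩` of the basis vector `bᵢ` in the state `ρ`. -/
noncomputable def DensityOp.population (ρ : DensityOp b) (i : ι) : ℝ :=
  RCLike.re ⟪b i, ρ.op (b i)⟫_ℂ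

theorem DensityOp.population_nonneg (ρ : DensityOp b) (i : ι) : 0 ≤ ρ.population i :=
  ρ.pos.re_inner_nonneg_right (b i)

theorem DensityOp.toReal_traceNorm (ρ : DensityOp b) : (traceNorm b ρ.op).toReal = 1 := by
  have h := ρ.trace_eq_one
  rw [opTrace_of_isPositive b ρ.pos] at h
  exact_mod_cast h

theorem DensityOp.hasSum_population (ρ : DensityOp b) : HasSum ρ.population 1 := by
  have := hasSum_re_inner_of_isPositive b ρ.pos ρ.traceClass
  rwa [ρ.toReal_traceNorm] at this

theorem DensityOp.population_le_one (ρ : DensityOp b) (i : ι) : ρ.population i ≤ 1 :=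
  le_hasSum ρ.hasSum_population i fun j _ => ρ.population_nonneg j

theorem DensityOp.inner_self_eq (ρ : DensityOp b) (i : ι) :
    ⟪b i, ρ.op (b i)⟫_ℂ = (ρ.population i : ℂ) := by
  have h0 := ρ.pos.inner_nonneg_right (b i)
  exact Complex.ext rfl (by simpa using ((Complex.le_def.1 h0).2).symm)

theorem DensityOp.continuous_population (i : ι) :
    Continuous fun ρ : DensityOp b => ρ.population i := by
  refine (LipschitzWith.of_dist_le_mul (K := 1) fun ρ σ => ?_).continuous
  have h := enorm_inner_le_traceNorm b (ρ.op - σ.op) (b.orthonormal.1 i).le (b.orthonormal.1 i).le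
  have h1 := ENNReal.toReal_mono (ρ.sub_ne_top σ) h
  rw [toReal_enorm, ← DensityOp.dist_def] at h1
  rw [NNReal.coe_one, one_mul, Real.dist_eq]
  refine le_trans ?_ h1
  have e : ρ.population i - σ.population i = RCLike.re ⟪b i, (ρ.op - σ.op) (b i)⟫_ℂ := by
    simp [DensityOp.population]
  rw [e]
  exact RCLike.abs_re_le_norm _

/-- The pure state of a basis vector. -/
noncomputable def basisState (b : HilbertBasis ι ℂ H) (i : ι) : DensityOp b :=
  pureState b (b i) (b.orthonormal.1 i)

/-- With respect to the vector `bₖ`, the operator `ρ - |bₖ⟩⟨bₖ|` splits into four blocks: the corner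
`ρₖₖ - 1`, two rank one blocks of norm at most `√(ρₖₖ (1 - ρₖₖ))`, and a positive block of trace
`1 - ρₖₖ`. -/
theorem DensityOp.dist_basisState_le (ρ : DensityOp b) (k : ι) :
    dist ρ (basisState b k) ≤ 4 * √(1 - ρ.population k) := by
  classical
  set r := ρ.population k with hr
  set P : H →L[ℂ] H := InnerProductSpace.rankOne ℂ (b k) (b k) with hP
  have hPz : ∀ z, P z = ⟪b k, z⟫_ℂ • b k := fun z => InnerProductSpace.rankOne_apply ..
  set u : H := ρ.op (b k) - (r : ℂ) • b k with hu
  have hsym := ρ.pos.inner_left_eq_inner_right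
  have hkk : ⟪b k, b k⟫_ℂ = 1 := by
    rw [inner_self_eq_norm_sq_to_K, b.orthonormal.1 k]; simp
  have hjk : ∀ j, j ≠ k → ⟪b j, b k⟫_ℂ = 0 := fun j hj => b.orthonormal.2 hj
  have hkj : ∀ j, j ≠ k → ⟪b k, b j⟫_ℂ = 0 := fun j hj => b.orthonormal.2 hj.symm
  set Q : H →L[ℂ] H := 1 - P with hQ
  have hQz : ∀ z, Q z = z - ⟪b k, z⟫_ℂ • b k := fun z => by simp [hQ, hPz]
  have hQs : ∀ x y, ⟪Q x, y⟫_ℂ = ⟪x, Q y⟫_ℂ := fun x y => by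
    rw [hQz, hQz, inner_sub_left, inner_sub_right, inner_smul_left, inner_smul_right,
      inner_conj_symm]
    ring
  have hQad : ContinuousLinearMap.adjoint Q = Q :=
    ((ContinuousLinearMap.eq_adjoint_iff Q Q).2 hQs).symm
  set T : H →L[ℂ] H := Q * ρ.op * ContinuousLinearMap.adjoint Q with hT
  have hTpos : T.IsPositive := ρ.pos.conj_adjoint Q
  have hTz : ∀ z, T z = Q (ρ.op (Q z)) := fun z => by
    rw [hT, hQad]; rfl
  have hr0 : 0 ≤ r := ρ.population_nonneg k
  have hr1 : r ≤ 1 := ρ.population_le_one k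
  have hTd : ∀ j, RCLike.re ⟪b j, T (b j)⟫_ℂ = if j = k then 0 else ρ.population j := by
    intro j
    rw [hTz, ← hQs]
    split_ifs with h
    · subst h
      have : Q (b j) = 0 := by rw [hQz, hkk, one_smul, sub_self]
      rw [this]; simp
    · have : Q (b j) = b j := by rw [hQz, hkj j h]; simp
      rw [this]; rfl
  have hTn : traceNorm b T = ENNReal.ofReal (1 - r) := by
    rw [traceNorm_of_isPositive b hTpos]
    simp only [hTd]
    have h1 := ρ.hasSum_population.update k 0
    have h2 : HasSum (fun j => if j = k then 0 else ρ.population j) (1 - r) := by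
      have e1 : Function.update ρ.population k 0 = fun j => if j = k then 0 else ρ.population j := by
        funext j
        by_cases h : j = k <;> simp [h]
      have e2 : 0 - ρ.population k + 1 = 1 - r := by rw [hr]; ring
      rw [e1, e2] at h1
      exact h1
    rw [← h2.tsum_eq, ENNReal.ofReal_tsum_of_nonneg _ h2.summable]
    intro j
    split_ifs
    · exact le_rfl
    · exact ρ.population_nonneg j
  have hun : ‖u‖ ≤ √(1 - r) := by
    refine Real.le_sqrt_of_sq_le ?_
    have h1 : ‖u‖ₑ ^ 2 ≤ ENNReal.ofReal (1 - r) := by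
      rw [parseval_enorm b u, ← hTn, traceNorm_of_isPositive b hTpos]
      refine ENNReal.tsum_le_tsum fun j => ?_
      rw [hTd, ← ofReal_norm, ← ENNReal.ofReal_pow (norm_nonneg _)]
      refine ENNReal.ofReal_le_ofReal ?_
      rw [hu, inner_sub_right, inner_smul_right]
      split_ifs with h
      · subst h
        rw [hkk, ρ.inner_self_eq]
        simp [hr]
      · rw [hjk j h, mul_zero, sub_zero]
        refine (norm_inner_sq_le_of_isPositive ρ.pos _ _).trans ?_
        exact mul_le_of_le_one_right (ρ.population_nonneg j) hr1
    rw [← ofReal_norm, ← ENNReal.ofReal_pow (norm_nonneg _)] at h1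
    exact (ENNReal.ofReal_le_ofReal_iff (by linarith)).1 h1
  have hdec : ρ.op - P = T + (((r - 1 : ℝ) : ℂ) • P +
      (InnerProductSpace.rankOne ℂ u (b k) + InnerProductSpace.rankOne ℂ (b k) u)) := by
    ext1 z
    have huz : ⟪u, z⟫_ℂ = ⟪b k, ρ.op z⟫_ℂ - r * ⟪b k, z⟫_ℂ := by
      rw [hu, inner_sub_left, inner_smul_left, hsym]; simp
    simp only [sub_apply, add_apply, smul_apply, InnerProductSpace.rankOne_apply, hTz, hPz, huz]
    rw [hQz z, map_sub, map_smul, hQz, inner_sub_right, inner_smul_right, ρ.inner_self_eq, ← hr]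
    have : ρ.op (b k) = u + (r : ℂ) • b k := by rw [hu]; abel
    rw [this]
    push_cast
    module
  have hPn : traceNorm b P ≤ 1 := by
    refine (traceNorm_rankOne_le b _ _).trans ?_
    rw [b.orthonormal.1 k]; simp
  have hle : traceNorm b (ρ.op - P) ≤
      ENNReal.ofReal ((1 - r) + ((1 - r) + (√(1 - r) + √(1 - r)))) := by
    have hs0 := Real.sqrt_nonneg (1 - r)
    rw [hdec, ENNReal.ofReal_add (by linarith) (by linarith),
      ENNReal.ofReal_add (by linarith) (by linarith), ENNReal.ofReal_add hs0 hs0]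
    refine (traceNorm_add_le b _ _).trans (add_le_add hTn.le ?_)
    refine (traceNorm_add_le b _ _).trans (add_le_add ?_ ?_)
    · rw [traceNorm_smul, ← ofReal_norm, Complex.norm_real, Real.norm_eq_abs, abs_sub_comm,
        abs_of_nonneg (by linarith)]
      exact mul_le_of_le_one_right zero_le hPn
    · refine (traceNorm_add_le b _ _).trans (add_le_add ?_ ?_)
      · refine (traceNorm_rankOne_le b _ _).trans (ENNReal.ofReal_le_ofReal ?_)
        rwa [b.orthonormal.1 k, mul_one]
      · refine (traceNorm_rankOne_le b _ _).trans (ENNReal.ofReal_le_ofReal ?_)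
        rwa [b.orthonormal.1 k, one_mul]
  have h1r : 1 - r ≤ √(1 - r) := by
    refine Real.le_sqrt_of_sq_le ?_
    nlinarith
  rw [DensityOp.dist_def]
  refine (ENNReal.toReal_mono ENNReal.ofReal_ne_top hle).trans ?_
  rw [ENNReal.toReal_ofReal (by have := Real.sqrt_nonneg (1 - r); linarith)]
  linarith

theorem DensityOp.dist_basisState_le_four (ρ : DensityOp b) (k : ι) :
    dist ρ (basisState b k) ≤ 4 := by
  refine (ρ.dist_basisState_le k).trans ?_
  have : √(1 - ρ.population k) ≤ 1 :=
    Real.sqrt_le_one.2 (by linarith [ρ.population_nonneg k])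
  linarith

end Population

/-! ### Weighted partial permutations of an orthonormal basis -/

section WeightedShift

set_option linter.unusedSectionVars false

variable {ι : Type*} {H : Type*} [NormedAddCommGroup H] [InnerProductSpace ℂ H] [CompleteSpace H]
  {b : HilbertBasis ι ℂ H}

theorem outcomeProb_nonneg (V : H →L[ℂ] H) (ρ : DensityOp b) : 0 ≤ outcomeProb V ρ := by
  rw [outcomeProb_eq]
  exact ENNReal.toReal_nonneg

/-- The operator `V` maps each basis vector `bᵢ` to the multiple `vᵢ` of the basis vector
`b_{σ i}`, where `σ` is injective on the indices with `vᵢ ≠ 0`. -/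
structure IsWeightedShift (b : HilbertBasis ι ℂ H) (V : H →L[ℂ] H) (v : ι → ℂ) (σ : ι → ι) :
    Prop where
  apply_basis : ∀ i, V (b i) = v i • b (σ i)
  inj : ∀ i j, v i ≠ 0 → v j ≠ 0 → σ i = σ j → i = j

namespace IsWeightedShift

variable {V W : H →L[ℂ] H} {v w : ι → ℂ} {σ τ : ι → ι}

theorem one : IsWeightedShift b (1 : H →L[ℂ] H) (fun _ => 1) id where
  apply_basis i := by simp
  inj _ _ _ _ h := h

theorem mul (hV : IsWeightedShift b V v σ) (hW : IsWeightedShift b W w τ) :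
    IsWeightedShift b (V * W) (fun i => w i * v (τ i)) (σ ∘ τ) where
  apply_basis i := by
    change V (W (b i)) = _
    rw [hW.apply_basis, map_smul, hV.apply_basis, smul_smul]
    rfl
  inj i j hi hj h :=
    hW.inj i j (left_ne_zero_of_mul hi) (left_ne_zero_of_mul hj)
      (hV.inj _ _ (right_ne_zero_of_mul hi) (right_ne_zero_of_mul hj) h)

theorem inner_adjoint_apply (hV : IsWeightedShift b V v σ) (i k : ι) :
    ⟪b i, ContinuousLinearMap.adjoint V (b k)⟫_ℂ =
      (starRingEnd ℂ) (v i) * ⟪b (σ i), b k⟫_ℂ := by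
  rw [ContinuousLinearMap.adjoint_inner_right, hV.apply_basis, inner_smul_left]

theorem adjoint_apply (hV : IsWeightedShift b V v σ) {i : ι} (hi : v i ≠ 0) :
    ContinuousLinearMap.adjoint V (b (σ i)) = (starRingEnd ℂ) (v i) • b i := by
  classical
  have ho := orthonormal_iff_ite.1 b.orthonormal
  apply b.repr.injective
  ext j
  rw [b.repr_apply_apply, b.repr_apply_apply, hV.inner_adjoint_apply, inner_smul_right, ho, ho]
  by_cases hji : j = i
  · simp [hji]
  · rw [if_neg hji]
    by_cases hj : v j = 0
    · simp [hj]
    · rw [if_neg fun h => hji (hV.inj _ _ hj hi h)]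
      simp

theorem adjoint_apply_eq_zero (hV : IsWeightedShift b V v σ) {k : ι}
    (hk : ∀ i, v i ≠ 0 → σ i ≠ k) : ContinuousLinearMap.adjoint V (b k) = 0 := by
  classical
  have ho := orthonormal_iff_ite.1 b.orthonormal
  apply b.repr.injective
  ext j
  rw [b.repr_apply_apply, hV.inner_adjoint_apply, ho]
  by_cases hj : v j = 0
  · simp [hj]
  · simp [hk j hj]

theorem inner_unnormalized (hV : IsWeightedShift b V v σ) (ρ : DensityOp b) {i : ι}
    (hi : v i ≠ 0) :
    RCLike.re ⟪b (σ i), unnormalized V ρ (b (σ i))⟫_ℂ = ‖v i‖ ^ 2 * ρ.population i := by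
  change RCLike.re ⟪b (σ i), V (ρ.op (ContinuousLinearMap.adjoint V (b (σ i))))⟫_ℂ = _
  rw [← ContinuousLinearMap.adjoint_inner_left, hV.adjoint_apply hi, map_smul, inner_smul_left,
    inner_smul_right, ρ.inner_self_eq, ← mul_assoc, Complex.conj_conj, Complex.mul_conj,
    ← Complex.ofReal_mul, Complex.normSq_eq_norm_sq]
  exact Complex.ofReal_re _

theorem hasSum_outcomeProb (hV : IsWeightedShift b V v σ) (ρ : DensityOp b) :
    HasSum (fun i => ‖v i‖ ^ 2 * ρ.population i) (outcomeProb V ρ) := by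
  have h := hasSum_re_inner_of_isPositive b (unnormalized_isPositive V ρ)
    (unnormalized_ne_top V ρ)
  rw [← outcomeProb_eq] at h
  let g : {i // v i ≠ 0} → ι := fun i => σ i
  have hg : Function.Injective g := fun i j hij => Subtype.ext (hV.inj _ _ i.2 j.2 hij)
  rw [← hg.hasSum_iff] at h
  · have e : (fun k => RCLike.re ⟪b k, unnormalized V ρ (b k)⟫_ℂ) ∘ g =
        (fun i => ‖v i‖ ^ 2 * ρ.population i) ∘ Subtype.val := by
      funext i
      exact hV.inner_unnormalized ρ i.2
    rw [e, Subtype.val_injective.hasSum_iff] at h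
    · exact h
    · intro i hi
      have : v i = 0 := by
        by_contra h0
        exact hi ⟨⟨i, h0⟩, rfl⟩
      simp [this]
  · intro k hk
    have : ContinuousLinearMap.adjoint V (b k) = 0 :=
      hV.adjoint_apply_eq_zero fun i hi hik => hk ⟨⟨i, hi⟩, hik⟩
    simp [unnormalized, this]

theorem population_postState (hV : IsWeightedShift b V v σ) (ρ : DensityOp b) {i : ι}
    (hi : v i ≠ 0) (hZ : outcomeProb V ρ ≠ 0) :
    (postState V ρ).population (σ i) = ‖v i‖ ^ 2 * ρ.population i / outcomeProb V ρ := by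
  rw [DensityOp.population, postState_op V ρ hZ, smul_apply, inner_smul_right,
    ← hV.inner_unnormalized ρ hi, ← Complex.ofReal_inv]
  change (((outcomeProb V ρ)⁻¹ : ℝ) * ⟪b (σ i), unnormalized V ρ (b (σ i))⟫_ℂ).re = _
  rw [Complex.re_ofReal_mul, div_eq_inv_mul]
  rfl

end IsWeightedShift

/-- If mass is distributed according to `q`, with total mass `Z`, the mean of `1 - q i / Z` is
controlled by the products `qᵢ qⱼ` over a finite set `s` and by the mass outside `s`. -/
theorem sub_sum_sq_div_le {s : Finset ι} [DecidableEq ι] {q : ι → ℝ} {Z : ℝ} (hZ : 0 < Z)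
    {B : ι → ι → ℝ} (hB : ∀ i j, q i * q j / Z ≤ B i j) :
    Z - ∑ i ∈ s, q i ^ 2 / Z ≤
      ∑ i ∈ s, ∑ j ∈ s.erase i, B i j + 2 * (Z - ∑ i ∈ s, q i) := by
  have h1 : ∑ i ∈ s, ∑ j ∈ s.erase i, q i * q j / Z ≤ ∑ i ∈ s, ∑ j ∈ s.erase i, B i j :=
    Finset.sum_le_sum fun i _ => Finset.sum_le_sum fun j _ => hB i j
  have h2 : ∑ i ∈ s, ∑ j ∈ s.erase i, q i * q j / Z =
      (∑ i ∈ s, q i) ^ 2 / Z - ∑ i ∈ s, q i ^ 2 / Z := by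
    rw [sq, Finset.sum_mul_sum, Finset.sum_div, ← Finset.sum_sub_distrib]
    refine Finset.sum_congr rfl fun i hi => ?_
    rw [Finset.sum_div, ← Finset.add_sum_erase s _ hi]
    ring
  set S := ∑ i ∈ s, q i
  have h3 : Z - S ^ 2 / Z ≤ 2 * (Z - S) := by
    rw [sub_le_iff_le_add, ← sub_le_iff_le_add', le_div_iff₀ hZ]
    nlinarith [sq_nonneg (Z - S)]
  linarith

variable {R : Type*} [Fintype R]

theorem integral_trajectoryKernel (V : R → H →L[ℂ] H) (ρ : DensityOp b) {f : DensityOp b → ℝ}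
    (hf : Measurable f) :
    ∫ σ, f σ ∂(trajectoryKernel b V ρ) =
      ∑ y, outcomeProb (V y) ρ * f (postState (V y) ρ) := by
  change ∫ σ, f σ ∂(∑ y, ENNReal.ofReal (outcomeProb (V y) ρ) •
    Measure.dirac (postState (V y) ρ)) = _
  have hi : ∀ y, Integrable f
      (ENNReal.ofReal (outcomeProb (V y) ρ) • Measure.dirac (postState (V y) ρ)) := fun y =>
    (integrable_dirac' hf.stronglyMeasurable (by simp)).smul_measure ENNReal.ofReal_ne_top
  rw [integral_finsetSum_measure fun y _ => hi y]
  refine Finset.sum_congr rfl fun y _ => ?_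
  rw [integral_smul_measure, integral_dirac' _ _ hf.stronglyMeasurable,
    ENNReal.toReal_ofReal (outcomeProb_nonneg _ _), smul_eq_mul]

variable {V : R → H →L[ℂ] H} {v : R → ι → ℂ} {σ : R → ι → ι}

theorem sum_outcomeProb_eq_one (hV : ∀ y, IsWeightedShift b (V y) (v y) (σ y))
    (hv : ∀ i, ∑ y, ‖v y i‖ ^ 2 = 1) (ρ : DensityOp b) : ∑ y, outcomeProb (V y) ρ = 1 := by
  have h := hasSum_sum (s := Finset.univ) fun y _ => (hV y).hasSum_outcomeProb ρ
  refine h.unique ?_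
  simp only [← Finset.sum_mul, hv, one_mul]
  exact ρ.hasSum_population

theorem isMarkovKernel_trajectoryKernel (hV : ∀ y, IsWeightedShift b (V y) (v y) (σ y))
    (hv : ∀ i, ∑ y, ‖v y i‖ ^ 2 = 1) : IsMarkovKernel (trajectoryKernel b V) := by
  refine ⟨fun ρ => ⟨?_⟩⟩
  change (∑ y, ENNReal.ofReal (outcomeProb (V y) ρ) • Measure.dirac (postState (V y) ρ))
    Set.univ = 1
  simp only [Measure.finsetSum_apply, Measure.smul_apply, smul_eq_mul, measure_univ, mul_one]
  rw [← ENNReal.ofReal_sum_of_nonneg fun y _ => outcomeProb_nonneg _ _,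
    sum_outcomeProb_eq_one hV hv, ENNReal.ofReal_one]

/-- After an outcome, the label `i` of the initial basis state has posterior probability
`qᵢ / Z`. The posterior state is close to the basis state `σ i` if this probability is close to
`1`, and on average over `i` it is so if the weights `vᵢ`, `vⱼ` of distinct labels do not
overlap. -/
theorem abs_outcome_sub_tsum_le [DecidableEq ι] {V : H →L[ℂ] H} {v : ι → ℂ} {σ : ι → ι}
    (hV : IsWeightedShift b V v σ) (ρ : DensityOp b) (s : Finset ι) {θ : ℝ} (hθ : 0 < θ)
    {f : DensityOp b → ℝ} (hf : LipschitzWith 1 f) {C : ℝ} (hC : ∀ i, |f (basisState b i)| ≤ C) :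
    |outcomeProb V ρ * f (postState V ρ) -
        ∑' i, ‖v i‖ ^ 2 * ρ.population i * f (basisState b (σ i))| ≤
      4 * (θ * outcomeProb V ρ +
        (∑ i ∈ s, ∑ j ∈ s.erase i, ‖v i‖ * ‖v j‖ +
          2 * (outcomeProb V ρ - ∑ i ∈ s, ‖v i‖ ^ 2 * ρ.population i)) / θ) := by
  set Z := outcomeProb V ρ
  set q : ι → ℝ := fun i => ‖v i‖ ^ 2 * ρ.population i with hq
  have hq0 : ∀ i, 0 ≤ q i := fun i => mul_nonneg (by positivity) (ρ.population_nonneg i)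
  have hqZ : HasSum q Z := hV.hasSum_outcomeProb ρ
  have hZ0 : 0 ≤ Z := outcomeProb_nonneg V ρ
  rcases hZ0.eq_or_lt with hZ | hZ
  · rw [← hZ] at hqZ
    have h0 : ∀ i, q i = 0 := fun i => congrFun ((hasSum_zero_iff_of_nonneg hq0).1 hqZ) i
    simp only [← hZ]
    have : ∀ i, ‖v i‖ ^ 2 * ρ.population i = 0 := h0
    simp only [this]
    have hs0 : s.sum q = 0 := Finset.sum_eq_zero fun i _ => h0 i
    simp only [zero_mul, tsum_zero, sub_zero, abs_zero, mul_zero, hs0]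
    positivity
  have hsum : Summable fun i => q i * f (basisState b (σ i)) := by
    refine Summable.of_norm_bounded (hqZ.summable.mul_right C) fun i => ?_
    rw [norm_mul, Real.norm_of_nonneg (hq0 i)]
    exact mul_le_mul_of_nonneg_left (hC _) (hq0 i)
  have hdiff : HasSum (fun i => q i * (f (postState V ρ) - f (basisState b (σ i))))
      (Z * f (postState V ρ) - ∑' i, q i * f (basisState b (σ i))) := by
    simp only [mul_sub]
    exact (hqZ.mul_right _).sub hsum.hasSum
  have hcorner : HasSum (fun i => if i ∈ s then q i ^ 2 / Z else 0) (∑ i ∈ s, q i ^ 2 / Z) := by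
    rw [← Finset.sum_congr rfl fun i (hi : i ∈ s) => if_pos (c := i ∈ s) (e := 0) hi]
    exact hasSum_sum_of_ne_finset_zero fun i hi => by simp [hi]
  have hbound : HasSum (fun i => 4 * (θ * q i + (q i - if i ∈ s then q i ^ 2 / Z else 0) / θ))
      (4 * (θ * Z + (Z - ∑ i ∈ s, q i ^ 2 / Z) / θ)) :=
    ((hqZ.mul_left θ).add ((hqZ.sub hcorner).div_const θ)).mul_left 4
  have hterm : ∀ i, ‖q i * (f (postState V ρ) - f (basisState b (σ i)))‖ ≤
      4 * (θ * q i + (q i - if i ∈ s then q i ^ 2 / Z else 0) / θ) := by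
    intro i
    rw [norm_mul, Real.norm_of_nonneg (hq0 i)]
    by_cases hi : v i = 0
    · have : q i = 0 := by simp [hq, hi]
      simp [this]
    have h1 : ‖f (postState V ρ) - f (basisState b (σ i))‖ ≤ 4 * √(1 - q i / Z) := by
      rw [← dist_eq_norm]
      have h2 := hf.dist_le_mul (postState V ρ) (basisState b (σ i))
      rw [NNReal.coe_one, one_mul] at h2
      have h3 := (postState V ρ).dist_basisState_le (σ i)
      rw [hV.population_postState ρ hi hZ.ne'] at h3
      exact h2.trans h3
    have hqi : q i / Z ≤ 1 :=
      (div_le_one hZ).2 (le_hasSum hqZ i fun j _ => hq0 j)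
    have h4 : √(1 - q i / Z) ≤ θ + (1 - q i / Z) / θ := by
      have h5 := Real.sq_sqrt (sub_nonneg.2 hqi)
      set x := √(1 - q i / Z)
      rw [← h5]
      have h7 : θ + x ^ 2 / θ = (θ * θ + x ^ 2) / θ := by field_simp
      rw [h7, le_div_iff₀ hθ]
      nlinarith [sq_nonneg (x - θ)]
    have h6 : q i * (4 * (θ + (1 - q i / Z) / θ)) =
        4 * (θ * q i + (q i - q i ^ 2 / Z) / θ) := by ring
    calc q i * ‖f (postState V ρ) - f (basisState b (σ i))‖
        ≤ q i * (4 * (θ + (1 - q i / Z) / θ)) :=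
          mul_le_mul_of_nonneg_left (h1.trans (by linarith)) (hq0 i)
      _ = 4 * (θ * q i + (q i - q i ^ 2 / Z) / θ) := h6
      _ ≤ _ := by
          split_ifs
          · exact le_rfl
          · have : 0 ≤ q i ^ 2 / Z := by positivity
            gcongr
  have hmain : |Z * f (postState V ρ) - ∑' i, q i * f (basisState b (σ i))| ≤
      4 * (θ * Z + (Z - ∑ i ∈ s, q i ^ 2 / Z) / θ) := by
    rw [← hdiff.tsum_eq, ← Real.norm_eq_abs]
    exact tsum_of_norm_bounded hbound hterm
  refine hmain.trans ?_
  gcongr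
  refine sub_sum_sq_div_le hZ fun i j => ?_
  -- `qᵢ qⱼ ≤ Z²` and `qᵢ qⱼ ≤ (‖vᵢ‖ ‖vⱼ‖)²`, so the geometric mean of both bounds applies.
  have hi := le_hasSum hqZ i fun j _ => hq0 j
  have hj := le_hasSum hqZ j fun j _ => hq0 j
  rw [div_le_iff₀ hZ]
  refine le_of_sq_le_sq ?_ (by positivity)
  have e1 : q i * q j ≤ Z * Z := mul_le_mul hi hj (hq0 j) hZ0
  have e2 : ∀ i, q i ≤ ‖v i‖ ^ 2 := fun i =>
    mul_le_of_le_one_right (by positivity) (ρ.population_le_one i)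
  have e3 : q i * q j ≤ ‖v i‖ ^ 2 * ‖v j‖ ^ 2 := mul_le_mul (e2 i) (e2 j) (hq0 j) (by positivity)
  calc (q i * q j) ^ 2 = (q i * q j) * (q i * q j) := sq _
    _ ≤ (‖v i‖ ^ 2 * ‖v j‖ ^ 2) * (Z * Z) :=
        mul_le_mul e3 e1 (mul_nonneg (hq0 i) (hq0 j)) (by positivity)
    _ = (‖v i‖ * ‖v j‖ * Z) ^ 2 := by ring

/-- The action on functions of the classical Markov chain with jump `i ↦ σ y i` of probability
`‖v y i‖²`. -/
noncomputable def jumpOp (v : R → ι → ℂ) (σ : R → ι → ι) (g : ι → ℝ) (i : ι) : ℝ :=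
  ∑ y, ‖v y i‖ ^ 2 * g (σ y i)

/-- The Hellinger affinity of the laws of the outcome for the initial labels `i` and `j`. -/
noncomputable def affinity (v : R → ι → ℂ) (i j : ι) : ℝ := ∑ y, ‖v y i‖ * ‖v y j‖

/-- Comparison of the trajectory with the classical chain of the labels. The error consists of the
affinities of distinct labels in the finite set `s` and the populations outside `s`; the parameter
`θ` comes from the inequality `√u ≤ θ + u / θ`. -/
theorem abs_integral_trajectoryKernel_le [DecidableEq ι]
    (hV : ∀ y, IsWeightedShift b (V y) (v y) (σ y))
    (hv : ∀ i, ∑ y, ‖v y i‖ ^ 2 = 1) (ρ : DensityOp b) (s : Finset ι) {θ : ℝ} (hθ : 0 < θ)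
    {f : DensityOp b → ℝ} (hf : LipschitzWith 1 f) {C : ℝ} (hC : ∀ i, |f (basisState b i)| ≤ C) :
    |∫ σ, f σ ∂(trajectoryKernel b V ρ)| ≤
      4 * (θ + (∑ i ∈ s, ∑ j ∈ s.erase i, affinity v i j +
          2 * (1 - ∑ i ∈ s, ρ.population i)) / θ) +
        (∑ i ∈ s, |jumpOp v σ (fun k => f (basisState b k)) i| +
          C * (1 - ∑ i ∈ s, ρ.population i)) := by
  classical
  rw [integral_trajectoryKernel V ρ hf.continuous.measurable]
  have hs1 : ∀ y, Summable fun i =>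
      ‖v y i‖ ^ 2 * ρ.population i * f (basisState b (σ y i)) := fun y => by
    refine Summable.of_norm_bounded (((hV y).hasSum_outcomeProb ρ).summable.mul_right C) fun i => ?_
    have h0 : 0 ≤ ‖v y i‖ ^ 2 * ρ.population i :=
      mul_nonneg (by positivity) (ρ.population_nonneg i)
    rw [norm_mul, Real.norm_of_nonneg h0]
    exact mul_le_mul_of_nonneg_left (hC _) h0
  set g : ι → ℝ := fun k => f (basisState b k) with hg
  have hgen : HasSum (fun i => ρ.population i * jumpOp v σ g i)
      (∑ y, ∑' i, ‖v y i‖ ^ 2 * ρ.population i * f (basisState b (σ y i))) := by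
    refine (hasSum_sum (s := Finset.univ) fun y _ => (hs1 y).hasSum).congr_fun fun i => ?_
    rw [jumpOp, Finset.mul_sum]
    exact Finset.sum_congr rfl fun y _ => by ring
  have hjump : ∀ i, |jumpOp v σ g i| ≤ C := fun i => by
    refine (Finset.abs_sum_le_sum_abs _ _).trans ?_
    calc ∑ y, |‖v y i‖ ^ 2 * g (σ y i)| ≤ ∑ y, ‖v y i‖ ^ 2 * C := by
          refine Finset.sum_le_sum fun y _ => ?_
          rw [abs_mul, abs_of_nonneg (by positivity)]
          exact mul_le_mul_of_nonneg_left (hC _) (by positivity)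
      _ = C := by rw [← Finset.sum_mul, hv, one_mul]
  have hcl : |∑ y, ∑' i, ‖v y i‖ ^ 2 * ρ.population i * f (basisState b (σ y i))| ≤
      ∑ i ∈ s, |jumpOp v σ g i| + C * (1 - ∑ i ∈ s, ρ.population i) := by
    have hin : HasSum (fun i => if i ∈ s then |jumpOp v σ g i| - C * ρ.population i else 0)
        (∑ i ∈ s, (|jumpOp v σ g i| - C * ρ.population i)) := by
      rw [← Finset.sum_congr rfl fun i (hi : i ∈ s) => if_pos (c := i ∈ s) (e := 0) hi]
      exact hasSum_sum_of_ne_finset_zero fun i hi => by simp [hi]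
    have hb := hin.add (ρ.hasSum_population.mul_left C)
    rw [← hgen.tsum_eq, ← Real.norm_eq_abs]
    refine (tsum_of_norm_bounded hb fun i => ?_).trans (le_of_eq ?_)
    · rw [norm_mul, Real.norm_of_nonneg (ρ.population_nonneg i), Real.norm_eq_abs]
      split_ifs
      · rw [sub_add_cancel]
        exact mul_le_of_le_one_left (abs_nonneg _) (ρ.population_le_one i)
      · rw [zero_add, mul_comm]
        exact mul_le_mul_of_nonneg_right (hjump i) (ρ.population_nonneg i)
    · rw [Finset.sum_sub_distrib, ← Finset.mul_sum]
      ring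
  have hq : |∑ y, outcomeProb (V y) ρ * f (postState (V y) ρ) -
      ∑ y, ∑' i, ‖v y i‖ ^ 2 * ρ.population i * f (basisState b (σ y i))| ≤
      4 * (θ + (∑ i ∈ s, ∑ j ∈ s.erase i, affinity v i j +
          2 * (1 - ∑ i ∈ s, ρ.population i)) / θ) := by
    rw [← Finset.sum_sub_distrib]
    refine (Finset.abs_sum_le_sum_abs _ _).trans ((Finset.sum_le_sum fun y _ =>
      abs_outcome_sub_tsum_le (hV y) ρ s hθ hf hC).trans (le_of_eq ?_))
    have e1 : ∑ y, ∑ i ∈ s, ∑ j ∈ s.erase i, ‖v y i‖ * ‖v y j‖ =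
        ∑ i ∈ s, ∑ j ∈ s.erase i, affinity v i j := by
      rw [Finset.sum_comm]
      refine Finset.sum_congr rfl fun i _ => ?_
      rw [Finset.sum_comm]
      rfl
    have e2 : ∑ y, ∑ i ∈ s, ‖v y i‖ ^ 2 * ρ.population i = ∑ i ∈ s, ρ.population i := by
      rw [Finset.sum_comm]
      exact Finset.sum_congr rfl fun i _ => by rw [← Finset.sum_mul, hv, one_mul]
    rw [← Finset.mul_sum, Finset.sum_add_distrib, ← Finset.mul_sum, ← Finset.sum_div,
      Finset.sum_add_distrib, ← Finset.mul_sum, Finset.sum_sub_distrib, e1, e2,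
      sum_outcomeProb_eq_one hV hv, mul_one]
  have := abs_add_le (∑ y, outcomeProb (V y) ρ * f (postState (V y) ρ) -
      ∑ y, ∑' i, ‖v y i‖ ^ 2 * ρ.population i * f (basisState b (σ y i)))
      (∑ y, ∑' i, ‖v y i‖ ^ 2 * ρ.population i * f (basisState b (σ y i)))
  rw [sub_add_cancel] at this
  linarith

end WeightedShift

/-! ### Iterating the trajectory kernel -/

section Words

set_option linter.unusedSectionVars false

variable {ι : Type*} {H : Type*} [NormedAddCommGroup H] [InnerProductSpace ℂ H] [CompleteSpace H]
  {b : HilbertBasis ι ℂ H}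

/-- The factor `(Tr W ρ W*)⁻¹` comes out; for `Tr W ρ W* = 0` the state `postState W ρ` is `ρ` and
the identity may fail. -/
theorem unnormalized_postState (V W : H →L[ℂ] H) (ρ : DensityOp b) (hW : outcomeProb W ρ ≠ 0) :
    unnormalized V (postState W ρ) = ((outcomeProb W ρ)⁻¹ : ℂ) • unnormalized (V * W) ρ := by
  have had : ContinuousLinearMap.adjoint (V * W) =
      ContinuousLinearMap.adjoint W * ContinuousLinearMap.adjoint V :=
    ContinuousLinearMap.adjoint_comp V W
  rw [unnormalized, postState_op W ρ hW, unnormalized, unnormalized, had, mul_smul_comm,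
    smul_mul_assoc]
  simp only [mul_assoc]

theorem outcomeProb_mul (V W : H →L[ℂ] H) (ρ : DensityOp b) :
    outcomeProb (V * W) ρ = outcomeProb W ρ * outcomeProb V (postState W ρ) := by
  have had : ContinuousLinearMap.adjoint (V * W) =
      ContinuousLinearMap.adjoint W * ContinuousLinearMap.adjoint V :=
    ContinuousLinearMap.adjoint_comp V W
  by_cases hW : outcomeProb W ρ = 0
  · have h0 : unnormalized W ρ = 0 := by
      apply eq_zero_of_traceNorm_eq_zero b
      rw [outcomeProb_eq, ENNReal.toReal_eq_zero_iff] at hW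
      exact hW.resolve_right (unnormalized_ne_top W ρ)
    have h1 : unnormalized (V * W) ρ = V * unnormalized W ρ * ContinuousLinearMap.adjoint V := by
      rw [unnormalized, unnormalized, had]
      simp only [mul_assoc]
    rw [hW, zero_mul, outcomeProb, h1, h0]
    simp [opTrace]
  · rw [outcomeProb_eq V, unnormalized_postState V W ρ hW, traceNorm_smul, ENNReal.toReal_mul,
      ← outcomeProb_eq, ← Complex.ofReal_inv, toReal_enorm, Complex.norm_real,
      Real.norm_of_nonneg (inv_nonneg.2 (outcomeProb_nonneg W ρ)),
      mul_inv_cancel_left₀ hW]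

theorem postState_mul (V W : H →L[ℂ] H) (ρ : DensityOp b) (h : outcomeProb (V * W) ρ ≠ 0) :
    postState (V * W) ρ = postState V (postState W ρ) := by
  have h' := h
  rw [outcomeProb_mul] at h'
  have hW := left_ne_zero_of_mul h'
  have hV := right_ne_zero_of_mul h'
  apply DensityOp.ext
  rw [postState_op _ _ h, postState_op _ _ hV, unnormalized_postState V W ρ hW, smul_smul,
    outcomeProb_mul]
  push_cast
  rw [mul_inv, mul_comm]

variable {R S : Type*} [Fintype R] [Fintype S]

theorem trajectoryKernel_apply_set (V : R → H →L[ℂ] H) (ρ : DensityOp b) (A : Set (DensityOp b)) :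
    trajectoryKernel b V ρ A =
      ∑ y, ENNReal.ofReal (outcomeProb (V y) ρ) * Measure.dirac (postState (V y) ρ) A := by
  change (∑ y, ENNReal.ofReal (outcomeProb (V y) ρ) • Measure.dirac (postState (V y) ρ)) A = _
  simp [Measure.finsetSum_apply]

theorem lintegral_trajectoryKernel (V : R → H →L[ℂ] H) (ρ : DensityOp b)
    {f : DensityOp b → ℝ≥0∞} (hf : Measurable f) :
    ∫⁻ σ, f σ ∂(trajectoryKernel b V ρ) =
      ∑ y, ENNReal.ofReal (outcomeProb (V y) ρ) * f (postState (V y) ρ) := by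
  change ∫⁻ σ, f σ ∂(∑ y, ENNReal.ofReal (outcomeProb (V y) ρ) •
    Measure.dirac (postState (V y) ρ)) = _
  rw [lintegral_finsetSum_measure]
  refine Finset.sum_congr rfl fun y _ => ?_
  rw [lintegral_smul_measure, lintegral_dirac' _ hf, smul_eq_mul]

theorem trajectoryKernel_comp (V : R → H →L[ℂ] H) (W : S → H →L[ℂ] H) :
    trajectoryKernel b V ∘ₖ trajectoryKernel b W =
      trajectoryKernel b fun z : S × R => V z.2 * W z.1 := by
  ext ρ A hA
  rw [Kernel.comp_apply' _ _ _ hA, lintegral_trajectoryKernel _ _ (Kernel.measurable_coe _ hA),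
    trajectoryKernel_apply_set, Fintype.sum_prod_type]
  refine Finset.sum_congr rfl fun z _ => ?_
  rw [trajectoryKernel_apply_set, Finset.mul_sum]
  refine Finset.sum_congr rfl fun y _ => ?_
  by_cases h : outcomeProb (V y * W z) ρ = 0
  · have h' := h
    rw [outcomeProb_mul, mul_eq_zero] at h'
    rcases h' with h' | h' <;> simp [h, h']
  · rw [postState_mul _ _ _ h, outcomeProb_mul,
      ENNReal.ofReal_mul (outcomeProb_nonneg _ _), mul_assoc]

theorem trajectoryKernel_comp_equiv (V : R → H →L[ℂ] H) (e : S ≃ R) :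
    trajectoryKernel b (fun z => V (e z)) = trajectoryKernel b V := by
  ext ρ A hA
  rw [trajectoryKernel_apply_set, trajectoryKernel_apply_set]
  exact Fintype.sum_equiv e _ _ fun _ => rfl

/-- The operator of a sequence of outcomes; the first outcome acts first. -/
noncomputable def wordOp (V : R → H →L[ℂ] H) : (t : ℕ) → (Fin t → R) → (H →L[ℂ] H)
  | 0, _ => 1
  | t + 1, w => wordOp V t (Fin.tail w) * V (w 0)

/-- The weight picked up by the basis vector with label `i` along a sequence of outcomes. -/
noncomputable def wordWeight (v : R → ι → ℂ) (σ : R → ι → ι) : (t : ℕ) → (Fin t → R) → ι → ℂ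
  | 0, _, _ => 1
  | t + 1, w, i => v (w 0) i * wordWeight v σ t (Fin.tail w) (σ (w 0) i)

/-- The label to which `i` is moved by a sequence of outcomes. -/
def wordTarget (σ : R → ι → ι) : (t : ℕ) → (Fin t → R) → ι → ι
  | 0, _, i => i
  | t + 1, w, i => wordTarget σ t (Fin.tail w) (σ (w 0) i)

theorem sum_word_succ {M : Type*} [AddCommMonoid M] (t : ℕ) (F : R → (Fin t → R) → M) :
    ∑ w : Fin (t + 1) → R, F (w 0) (Fin.tail w) = ∑ y, ∑ w : Fin t → R, F y w := by
  rw [← Fintype.sum_prod_type']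
  refine (Fintype.sum_equiv (Fin.consEquiv fun _ => R) _ _ fun z => ?_).symm
  simp [Fin.consEquiv]

variable {V : R → H →L[ℂ] H} {v : R → ι → ℂ} {σ : R → ι → ι}

theorem isWeightedShift_wordOp (hV : ∀ y, IsWeightedShift b (V y) (v y) (σ y)) :
    ∀ (t : ℕ) (w : Fin t → R),
      IsWeightedShift b (wordOp V t w) (wordWeight v σ t w) (wordTarget σ t w)
  | 0, _ => IsWeightedShift.one
  | t + 1, w => (isWeightedShift_wordOp hV t (Fin.tail w)).mul (hV (w 0))

/-- Sequences of `t` outcomes realize the `t`-th power of the classical transition operator. -/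
theorem jumpOp_wordWeight (v : R → ι → ℂ) (σ : R → ι → ι) (g : ι → ℝ) (t : ℕ) :
    jumpOp (wordWeight v σ t) (wordTarget σ t) g = (jumpOp v σ)^[t] g := by
  induction t with
  | zero =>
    funext i
    simp [jumpOp, wordWeight, wordTarget]
  | succ t ih =>
    rw [Function.iterate_succ_apply', ← ih]
    funext i
    have := sum_word_succ t fun y w => ‖v y i * wordWeight v σ t w (σ y i)‖ ^ 2 *
      g (wordTarget σ t w (σ y i))
    refine this.trans (Finset.sum_congr rfl fun y _ => ?_)
    rw [jumpOp, Finset.mul_sum]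
    exact Finset.sum_congr rfl fun w _ => by rw [norm_mul, mul_pow, mul_assoc]

theorem affinity_wordWeight_zero (v : R → ι → ℂ) (σ : R → ι → ι) (i j : ι) :
    affinity (wordWeight v σ 0) i j = 1 := by
  simp [affinity, wordWeight]

theorem affinity_wordWeight_succ (v : R → ι → ℂ) (σ : R → ι → ι) (t : ℕ) (i j : ι) :
    affinity (wordWeight v σ (t + 1)) i j =
      ∑ y, ‖v y i‖ * ‖v y j‖ * affinity (wordWeight v σ t) (σ y i) (σ y j) := by
  have := sum_word_succ t fun y w =>
    ‖v y i * wordWeight v σ t w (σ y i)‖ * ‖v y j * wordWeight v σ t w (σ y j)‖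
  refine this.trans (Finset.sum_congr rfl fun y _ => ?_)
  rw [affinity, Finset.mul_sum]
  exact Finset.sum_congr rfl fun w _ => by rw [norm_mul, norm_mul]; ring

theorem affinity_comm (v : R → ι → ℂ) (i j : ι) : affinity v i j = affinity v j i :=
  Finset.sum_congr rfl fun _ _ => mul_comm _ _

theorem affinity_nonneg (v : R → ι → ℂ) (i j : ι) : 0 ≤ affinity v i j :=
  Finset.sum_nonneg fun _ _ => by positivity

theorem jumpOp_one (hv : ∀ i, ∑ y, ‖v y i‖ ^ 2 = 1) (c : ℝ) :
    jumpOp v σ (fun _ => c) = fun _ => c := by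
  funext i
  rw [jumpOp, ← Finset.sum_mul, hv, one_mul]

theorem sum_norm_wordWeight_sq (hv : ∀ i, ∑ y, ‖v y i‖ ^ 2 = 1) (t : ℕ) (i : ι) :
    ∑ w, ‖wordWeight v σ t w i‖ ^ 2 = 1 := by
  have h1 := congrFun (jumpOp_wordWeight v σ (fun _ => (1 : ℝ)) t) i
  have h2 : (jumpOp v σ)^[t] (fun _ => (1 : ℝ)) = fun _ => 1 :=
    Function.iterate_fixed (jumpOp_one hv 1) t
  rw [h2] at h1
  simpa [jumpOp] using h1

/-- The `t`-step kernel is the trajectory kernel of the sequences of `t` outcomes. -/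
theorem iterate_bind_trajectoryKernel (V : R → H →L[ℂ] H) (t : ℕ) :
    ∀ ν : Measure (DensityOp b), (fun μ => μ.bind (trajectoryKernel b V))^[t] ν =
      ν.bind (trajectoryKernel b (wordOp V t)) := by
  induction t with
  | zero =>
    intro ν
    have : trajectoryKernel b (wordOp V 0) = Kernel.id := by
      ext ρ A hA
      have hu : unnormalized (1 : H →L[ℂ] H) ρ = ρ.op := by
        have : ContinuousLinearMap.adjoint (1 : H →L[ℂ] H) = 1 :=
          ((ContinuousLinearMap.eq_adjoint_iff _ _).2 fun _ _ => rfl).symm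
        rw [unnormalized, this, one_mul, mul_one]
      have hp : outcomeProb (1 : H →L[ℂ] H) ρ = 1 := by
        rw [outcomeProb, hu, ρ.trace_eq_one, Complex.one_re]
      have hs : postState (1 : H →L[ℂ] H) ρ = ρ := by
        apply DensityOp.ext
        rw [postState_op _ _ (by simp [hp]), hu, hp]
        simp
      rw [trajectoryKernel_apply_set]
      simp [wordOp, hp, hs, Kernel.id_apply]
    rw [this, Function.iterate_zero_apply]
    exact (Measure.id_comp).symm
  | succ t ih =>
    intro ν
    rw [Function.iterate_succ_apply, ih]
    have e := trajectoryKernel_comp_equiv (b := b)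
      (fun z : R × (Fin t → R) => wordOp V t z.2 * V z.1) (Fin.consEquiv fun _ => R).symm
    have : trajectoryKernel b (wordOp V (t + 1)) =
        trajectoryKernel b (wordOp V t) ∘ₖ trajectoryKernel b V := by
      rw [trajectoryKernel_comp, ← e]
      rfl
    rw [this]
    exact Measure.comp_assoc

end Words

/-! ### Nearest neighbour operators on sequences -/

/-- The tridiagonal operator `(L f)(n) = α n f(n + 1) + β n f(n) + γ n f(n - 1)`. At `n = 0` the
value `f 0` stands in for the missing `f (-1)`. -/
def triOp (α β γ : ℕ → ℝ) : (ℕ → ℝ) →ₗ[ℝ] (ℕ → ℝ) where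
  toFun f n := α n * f (n + 1) + β n * f n + γ n * f (n - 1)
  map_add' f g := by ext n; simp only [Pi.add_apply]; ring
  map_smul' c f := by ext n; simp only [Pi.smul_apply, smul_eq_mul, RingHom.id_apply]; ring

section TriOp

variable {α β γ : ℕ → ℝ}

theorem triOp_apply (f : ℕ → ℝ) (n : ℕ) :
    triOp α β γ f n = α n * f (n + 1) + β n * f n + γ n * f (n - 1) := rfl

theorem triOp_mono (hα : ∀ n, 0 ≤ α n) (hβ : ∀ n, 0 ≤ β n) (hγ : ∀ n, 0 ≤ γ n) :
    Monotone (triOp α β γ) := by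
  intro f g h n
  rw [triOp_apply, triOp_apply]
  have h1 := mul_le_mul_of_nonneg_left (h (n + 1)) (hα n)
  have h2 := mul_le_mul_of_nonneg_left (h n) (hβ n)
  have h3 := mul_le_mul_of_nonneg_left (h (n - 1)) (hγ n)
  linarith

theorem triOp_iterate_mono (hα : ∀ n, 0 ≤ α n) (hβ : ∀ n, 0 ≤ β n) (hγ : ∀ n, 0 ≤ γ n) (t : ℕ) :
    Monotone (triOp α β γ ^ t) := by
  rw [Module.End.coe_pow]
  exact (triOp_mono hα hβ hγ).iterate t

/-- If a positive operator `L` has a Lyapunov function `h ≥ 0` with `L h ≤ h - 1`, the sum of all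
`Lᵗ 1` is at most `h`. -/
theorem tendsto_triOp_pow_one (hα : ∀ n, 0 ≤ α n) (hβ : ∀ n, 0 ≤ β n) (hγ : ∀ n, 0 ≤ γ n)
    {h : ℕ → ℝ} (h0 : 0 ≤ h) (hh : triOp α β γ h ≤ h - 1) (n : ℕ) :
    Tendsto (fun t => (triOp α β γ ^ t) 1 n) atTop (𝓝 0) := by
  have hnn : ∀ t (f : ℕ → ℝ), 0 ≤ f → 0 ≤ (triOp α β γ ^ t) f := fun t f hf => by
    have := triOp_iterate_mono hα hβ hγ t hf
    rwa [map_zero] at this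
  have hsum : ∀ t, ∑ j ∈ Finset.range t, (triOp α β γ ^ j) 1 n + (triOp α β γ ^ t) h n ≤ h n := by
    intro t
    induction t with
    | zero => simp
    | succ t ih =>
      have h1 := triOp_iterate_mono hα hβ hγ t hh n
      rw [map_sub] at h1
      have h2 : (triOp α β γ ^ (t + 1)) h n = (triOp α β γ ^ t) (triOp α β γ h) n := by
        rw [pow_succ]; rfl
      rw [Finset.sum_range_succ, h2]
      simp only [Pi.sub_apply] at h1
      linarith
  refine (summable_of_sum_range_le (c := h n) (fun t => hnn t 1 zero_le_one n)
    fun t => ?_).tendsto_atTop_zero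
  have h1 := hnn t h h0 n
  have h2 := hsum t
  simp only [Pi.zero_apply] at h1
  linarith

end TriOp

/-! ### The birth-death chain of the photon number -/

/-- Death rates `b` for which the birth-death chain with birth rates `a n = x b (n + 1)` is
irreducible and aperiodic, and reversible with respect to the weights `xⁿ`. -/
structure IsDeathRate (x : ℝ) (b : ℕ → ℝ) : Prop where
  x_pos : 0 < x
  x_lt_one : x < 1
  zero : b 0 = 0
  pos : ∀ n, 0 < b (n + 1)
  le : ∀ n, (1 + x) * b n ≤ 1

/-- The transition operator of the birth-death chain. -/
noncomputable def chainOp (x : ℝ) (b : ℕ → ℝ) : (ℕ → ℝ) →ₗ[ℝ] (ℕ → ℝ) :=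
  triOp (fun n => x * b (n + 1)) (fun n => 1 - x * b (n + 1) - b n) b

/-- The operator that intertwines the transition operator with the discrete gradient. -/
noncomputable def gradOp (x : ℝ) (b : ℕ → ℝ) : (ℕ → ℝ) →ₗ[ℝ] (ℕ → ℝ) :=
  triOp (fun n => x * b (n + 2)) (fun n => 1 - (1 + x) * b (n + 1)) b

/-- The transition operator of the chain that is killed below the level `d`, as a function of the
height above that level. -/
noncomputable def killedOp (x : ℝ) (b : ℕ → ℝ) (d : ℕ) : (ℕ → ℝ) →ₗ[ℝ] (ℕ → ℝ) :=
  triOp (fun n => x * b (n + d + 1)) (fun n => 1 - x * b (n + d + 1) - b (n + d))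
    (fun n => if n = 0 then 0 else b (n + d))

namespace IsDeathRate

variable {x : ℝ} {b : ℕ → ℝ}

theorem nonneg (hb : IsDeathRate x b) (n : ℕ) : 0 ≤ b n := by
  cases n with
  | zero => exact hb.zero.ge
  | succ n => exact (hb.pos n).le

theorem hold_nonneg (hb : IsDeathRate x b) (m n : ℕ) : 0 ≤ 1 - x * b m - b n := by
  have h1 := hb.le m
  have h2 := hb.le n
  have hx := hb.x_pos
  have h3 : (1 + x) * (1 - x * b m - b n) = (1 + x) - x * ((1 + x) * b m) - (1 + x) * b n := by ring
  have h4 : 0 ≤ (1 + x) * (1 - x * b m - b n) := by rw [h3]; nlinarith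
  exact nonneg_of_mul_nonneg_right h4 (by linarith)

/-- With `a n = x b (n + 1)` the function `h n = (n + 1) / ((1 - x) b (n + 1))` solves
`gradOp h = h - 1`. It is the gradient of the solution of the Poisson equation for the mean photon
number. -/
theorem tendsto_gradOp_pow_one (hb : IsDeathRate x b) (n : ℕ) :
    Tendsto (fun t => (gradOp x b ^ t) 1 n) atTop (𝓝 0) := by
  have hx := hb.x_pos
  have hx1 : 0 < 1 - x := sub_pos.2 hb.x_lt_one
  refine tendsto_triOp_pow_one (h := fun n => (n + 1) / ((1 - x) * b (n + 1)))
    (fun n => mul_nonneg hx.le (hb.nonneg _)) (fun n => sub_nonneg.2 (hb.le _)) hb.nonneg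
    (fun n => div_nonneg (by positivity) (mul_nonneg hx1.le (hb.nonneg _))) (fun n => ?_) n
  rw [triOp_apply]
  have e1 := (hb.pos n).ne'
  have e2 := (hb.pos (n + 1)).ne'
  have e4 := hx1.ne'
  have e3 : b n * (((n - 1 : ℕ) + 1 : ℝ) / ((1 - x) * b (n - 1 + 1))) = n / (1 - x) := by
    cases n with
    | zero => simp [hb.zero]
    | succ n =>
      have := (hb.pos n).ne'
      simp only [Nat.add_sub_cancel]
      push_cast
      field_simp
  simp only [Pi.sub_apply, Pi.one_apply]
  rw [e3]
  push_cast
  refine le_of_eq ?_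
  field_simp
  ring

/-- The function `h n = ∑ᵢ 1 / ((1 - x) b (i + d + 1))`, with the sum over `i ≤ n`, solves
`killedOp h = h - 1` for the killing below the level `d + 1`. It is the mean time until the chain
is killed. The level `0` is excluded because the chain cannot go below it. -/
theorem tendsto_killedOp_pow_one (hb : IsDeathRate x b) (d : ℕ) (n : ℕ) :
    Tendsto (fun t => (killedOp x b (d + 1) ^ t) 1 n) atTop (𝓝 0) := by
  have hx := hb.x_pos
  have hx1 : 0 < 1 - x := sub_pos.2 hb.x_lt_one
  refine tendsto_triOp_pow_one
    (h := fun n => ∑ i ∈ Finset.range (n + 1), 1 / ((1 - x) * b (i + (d + 1))))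
    (fun n => mul_nonneg hx.le (hb.nonneg _)) (fun n => hb.hold_nonneg _ _) (fun n => ?_)
    (fun n => Finset.sum_nonneg fun i _ =>
      div_nonneg zero_le_one (mul_nonneg hx1.le (hb.nonneg _))) (fun n => ?_) n
  · split_ifs
    · exact le_rfl
    · exact hb.nonneg _
  · rw [triOp_apply]
    have e4 := hx1.ne'
    have e5 : ∀ m, b (m + (d + 1)) ≠ 0 := fun m => (hb.pos (m + d)).ne'
    simp only [Pi.sub_apply, Pi.one_apply]
    refine le_of_eq ?_
    cases n with
    | zero =>
      have e6 := e5 0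
      have e7 := e5 1
      have e8 : 0 + (d + 1) + 1 = 1 + (d + 1) := by ring
      simp only [Finset.sum_range_succ, Finset.sum_range_zero, zero_add, if_true, zero_mul,
        add_zero] at e6 ⊢
      rw [show d + 1 + 1 = 1 + (d + 1) by ring]
      field_simp
      ring
    | succ n =>
      have e6 := e5 (n + 1)
      have e7 := e5 (n + 2)
      have e8 : n + 1 + (d + 1) + 1 = n + 2 + (d + 1) := by ring
      have e9 : n + 1 + 1 = n + 2 := by ring
      simp only [Nat.add_sub_cancel, Nat.succ_ne_zero, if_false, e8, e9]
      rw [Finset.sum_range_succ _ (n + 2), Finset.sum_range_succ _ (n + 1)]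
      field_simp
      ring

/-- The discrete gradient `D` satisfies `D (chainOp f) = gradOp (D f)`, where `gradOp` is
positive. -/
theorem abs_chainOp_sub_le (hb : IsDeathRate x b) {f r : ℕ → ℝ} (h : ∀ n, |f (n + 1) - f n| ≤ r n) (n : ℕ) :
    |chainOp x b f (n + 1) - chainOp x b f n| ≤ gradOp x b r n := by
  have hx := hb.x_pos
  have e : chainOp x b f (n + 1) - chainOp x b f n =
      x * b (n + 2) * (f (n + 2) - f (n + 1)) + (1 - (1 + x) * b (n + 1)) * (f (n + 1) - f n) +
        b n * (f n - f (n - 1)) := by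
    simp only [chainOp, triOp_apply, Nat.add_sub_cancel]
    ring
  have h1 : |x * b (n + 2) * (f (n + 2) - f (n + 1))| ≤ x * b (n + 2) * r (n + 1) := by
    have h0 := mul_nonneg hx.le (hb.nonneg (n + 2))
    rw [abs_mul, abs_of_nonneg h0]
    exact mul_le_mul_of_nonneg_left (h _) h0
  have h2 : |(1 - (1 + x) * b (n + 1)) * (f (n + 1) - f n)| ≤ (1 - (1 + x) * b (n + 1)) * r n := by
    have h0 := sub_nonneg.2 (hb.le (n + 1))
    rw [abs_mul, abs_of_nonneg h0]
    exact mul_le_mul_of_nonneg_left (h _) h0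
  have h3 : |b n * (f n - f (n - 1))| ≤ b n * r (n - 1) := by
    cases n with
    | zero => simp [hb.zero]
    | succ n =>
      rw [abs_mul, abs_of_nonneg (hb.nonneg _)]
      exact mul_le_mul_of_nonneg_left (h n) (hb.nonneg _)
  rw [e, gradOp, triOp_apply]
  exact (abs_add_le _ _).trans (add_le_add ((abs_add_le _ _).trans (add_le_add h1 h2)) h3)

theorem abs_chainOp_pow_sub_le (hb : IsDeathRate x b) {f : ℕ → ℝ} {C : ℝ} (h : ∀ n, |f (n + 1) - f n| ≤ C) (t n : ℕ) :
    |(chainOp x b ^ t) f (n + 1) - (chainOp x b ^ t) f n| ≤ C * (gradOp x b ^ t) 1 n := by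
  induction t generalizing n with
  | zero => simpa using h n
  | succ t ih =>
    have := hb.abs_chainOp_sub_le (r := C • (gradOp x b ^ t) 1) ih n
    rw [map_smul] at this
    rw [pow_succ', pow_succ']
    exact this

theorem hasSum_geometric (hb : IsDeathRate x b) : HasSum (fun n : ℕ => (1 - x) * x ^ n) 1 := by
  have := (hasSum_geometric_of_lt_one hb.x_pos.le hb.x_lt_one).mul_left (1 - x)
  rwa [mul_inv_cancel₀ (sub_pos.2 hb.x_lt_one).ne'] at this

theorem summable_geometric_mul (hb : IsDeathRate x b) {f : ℕ → ℝ} {C : ℝ} (hf : ∀ n, |f n| ≤ C) :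
    Summable fun n : ℕ => (1 - x) * x ^ n * f n := by
  have h0 : ∀ n : ℕ, 0 ≤ (1 - x) * x ^ n := fun n =>
    mul_nonneg (sub_nonneg.2 hb.x_lt_one.le) (pow_nonneg hb.x_pos.le n)
  refine Summable.of_norm_bounded (hb.hasSum_geometric.summable.mul_right C) fun n => ?_
  rw [norm_mul, Real.norm_of_nonneg (h0 n)]
  exact mul_le_mul_of_nonneg_left (hf n) (h0 n)

theorem abs_chainOp_le (hb : IsDeathRate x b) {f : ℕ → ℝ} {C : ℝ} (hf : ∀ n, |f n| ≤ C) (n : ℕ) :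
    |chainOp x b f n| ≤ C := by
  have h0 := mul_nonneg hb.x_pos.le (hb.nonneg (n + 1))
  have h1 := hb.hold_nonneg (n + 1) n
  have h2 := hb.nonneg n
  rw [chainOp, triOp_apply]
  refine (abs_add_le _ _).trans ((add_le_add_left (abs_add_le _ _) _).trans ?_)
  rw [abs_mul (x * b (n + 1)), abs_mul (1 - _ - _), abs_mul (b n), abs_of_nonneg h0, abs_of_nonneg h1, abs_of_nonneg h2]
  have k0 := mul_le_mul_of_nonneg_left (hf (n + 1)) h0
  have k1 := mul_le_mul_of_nonneg_left (hf n) h1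
  have k2 := mul_le_mul_of_nonneg_left (hf (n - 1)) h2
  linarith

/-- The geometric distribution is stationary. The net flux through each bond is
`F n = (1 - x) xⁿ b n (f n - f (n - 1))`, by detailed balance. -/
theorem hasSum_geometric_mul_chainOp (hb : IsDeathRate x b) {f : ℕ → ℝ} {C : ℝ} (hf : ∀ n, |f n| ≤ C) :
    HasSum (fun n : ℕ => (1 - x) * x ^ n * chainOp x b f n) (∑' n : ℕ, (1 - x) * x ^ n * f n) := by
  set F : ℕ → ℝ := fun n => (1 - x) * x ^ n * (b n * (f n - f (n - 1))) with hF
  have hFs : Summable F := by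
    refine hb.summable_geometric_mul (C := 1 * (C + C)) fun n => ?_
    have hbn : b n ≤ 1 := by
      have h1 := hb.le n
      have h2 := mul_nonneg hb.x_pos.le (hb.nonneg n)
      linarith
    rw [abs_mul, abs_of_nonneg (hb.nonneg n)]
    exact mul_le_mul hbn ((abs_sub _ _).trans (add_le_add (hf _) (hf _))) (abs_nonneg _) zero_le_one
  have h1 : HasSum (fun n => F (n + 1)) (∑' n, F n) := by
    have := (hasSum_nat_add_iff' 1).2 hFs.hasSum
    simpa [hF, hb.zero] using this
  have h2 := ((h1.sub hFs.hasSum).add (hb.summable_geometric_mul hf).hasSum)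
  rw [sub_self, zero_add] at h2
  refine h2.congr_fun fun n => ?_
  simp only [hF, chainOp, triOp_apply, Nat.add_sub_cancel]
  ring

theorem hasSum_geometric_mul_chainOp_pow (hb : IsDeathRate x b) {f : ℕ → ℝ} {C : ℝ} (hf : ∀ n, |f n| ≤ C) (t : ℕ) :
    HasSum (fun n : ℕ => (1 - x) * x ^ n * (chainOp x b ^ t) f n)
      (∑' n : ℕ, (1 - x) * x ^ n * f n) := by
  have hbd : ∀ t n, |(chainOp x b ^ t) f n| ≤ C := fun t => by
    induction t with
    | zero => simpa using hf
    | succ t ih => rw [pow_succ']; exact hb.abs_chainOp_le ih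
  induction t with
  | zero => simpa using (hb.summable_geometric_mul hf).hasSum
  | succ t ih =>
    have := hb.hasSum_geometric_mul_chainOp (hbd t)
    rw [ih.tsum_eq] at this
    rw [pow_succ']
    exact this

/-- Convergence to the geometric distribution, uniformly over bounded functions. -/
theorem exists_abs_chainOp_pow_sub_le (hb : IsDeathRate x b) (n : ℕ) :
    ∃ e : ℕ → ℝ, Tendsto e atTop (𝓝 0) ∧ ∀ (f : ℕ → ℝ) (C : ℝ), (∀ n, |f n| ≤ C) → ∀ t,
      |(chainOp x b ^ t) f n - ∑' m : ℕ, (1 - x) * x ^ m * f m| ≤ C * e t := by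
  have hg0 : ∀ t k, 0 ≤ (gradOp x b ^ t) 1 k := fun t k => by
    have h := triOp_iterate_mono (fun n => mul_nonneg hb.x_pos.le (hb.nonneg (n + 2)))
      (fun n => sub_nonneg.2 (hb.le (n + 1))) hb.nonneg t (zero_le_one : (0 : ℕ → ℝ) ≤ 1) k
    rw [map_zero] at h
    exact h
  set G : ℕ → ℕ → ℝ := fun t m => ∑ k ∈ Finset.range m, (gradOp x b ^ t) 1 k with hG
  have hG0 : ∀ t m, 0 ≤ G t m := fun t m => Finset.sum_nonneg fun k _ => hg0 t k
  have hGmono : ∀ t, Monotone (G t) := fun t i j hij =>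
    Finset.sum_le_sum_of_subset_of_nonneg (Finset.range_mono hij) fun k _ _ => hg0 t k
  have hw0 : ∀ m : ℕ, 0 ≤ (1 - x) * x ^ m := fun m =>
    mul_nonneg (sub_nonneg.2 hb.x_lt_one.le) (pow_nonneg hb.x_pos.le m)
  refine ⟨fun t => ∑' m : ℕ, (1 - x) * x ^ m * (4 * min 1 (G t (n + m))), ?_, ?_⟩
  · have h0 : ∑' m : ℕ, (1 - x) * x ^ m * (4 * min 1 (0 : ℝ)) = 0 := by simp
    rw [← h0]
    refine tendsto_tsum_of_dominated_convergence (bound := fun m => (1 - x) * x ^ m * 4)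
      (hb.hasSum_geometric.summable.mul_right 4) (fun m => ?_) (Eventually.of_forall fun t m => ?_)
    · have hGt : Tendsto (fun t => G t (n + m)) atTop (𝓝 0) := by
        have := tendsto_finsetSum (Finset.range (n + m))
          fun k _ => hb.tendsto_gradOp_pow_one k
        simpa using this
      exact ((tendsto_const_nhds.min hGt).const_mul 4).const_mul _
    · have hm0 : 0 ≤ min 1 (G t (n + m)) := le_min zero_le_one (hG0 _ _)
      rw [Real.norm_of_nonneg (mul_nonneg (hw0 m) (by positivity))]
      exact mul_le_mul_of_nonneg_left (by linarith [min_le_left 1 (G t (n + m))]) (hw0 m)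
  · intro f C hf t
    have hC : 0 ≤ C := (abs_nonneg _).trans (hf 0)
    set g := (chainOp x b ^ t) f with hg
    have hgC : ∀ m, |g m| ≤ C := by
      rw [hg]
      clear_value g
      clear hg g
      induction t with
      | zero => simpa using hf
      | succ t ih => rw [pow_succ']; exact hb.abs_chainOp_le ih
    have hstep : ∀ m, |g (m + 1) - g m| ≤ 2 * C * (gradOp x b ^ t) 1 m :=
      hb.abs_chainOp_pow_sub_le (fun m => (abs_sub _ _).trans (by linarith [hf (m + 1), hf m])) t
    have hfrom0 : ∀ m, |g m - g 0| ≤ 2 * C * G t m := by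
      intro m
      rw [← Finset.sum_range_sub, hG, Finset.mul_sum]
      exact (Finset.abs_sum_le_sum_abs _ _).trans (Finset.sum_le_sum fun k _ => hstep k)
    have hclose : ∀ m, |g n - g m| ≤ C * (4 * min 1 (G t (n + m))) := by
      intro m
      have h1 : |g n - g m| ≤ 2 * C := (abs_sub _ _).trans (by linarith [hgC n, hgC m])
      have h2 : |g n - g m| ≤ 2 * C * G t n + 2 * C * G t m := by
        have := abs_sub_le (g n) (g 0) (g m)
        rw [abs_sub_comm (g 0)] at this
        linarith [hfrom0 n, hfrom0 m]
      have h3 := mul_le_mul_of_nonneg_left (hGmono t (Nat.le_add_right n m)) hC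
      have h4 := mul_le_mul_of_nonneg_left (hGmono t (Nat.le_add_left m n)) hC
      rcases min_choice 1 (G t (n + m)) with h | h <;> rw [h] <;> linarith
    have hsum : HasSum (fun m : ℕ => (1 - x) * x ^ m * (g n - g m))
        (g n - ∑' m : ℕ, (1 - x) * x ^ m * f m) := by
      have := (hb.hasSum_geometric.mul_right (g n)).sub (hb.hasSum_geometric_mul_chainOp_pow hf t)
      rw [one_mul] at this
      exact this.congr_fun fun m => mul_sub _ _ _
    have hbd : Summable fun m : ℕ => (1 - x) * x ^ m * (4 * min 1 (G t (n + m))) := by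
      refine hb.summable_geometric_mul (C := 4) fun m => ?_
      have hm0 : 0 ≤ min 1 (G t (n + m)) := le_min zero_le_one (hG0 _ _)
      rw [abs_of_nonneg (by positivity)]
      linarith [min_le_left 1 (G t (n + m))]
    rw [← hsum.tsum_eq, ← Real.norm_eq_abs]
    refine tsum_of_norm_bounded (hbd.hasSum.mul_left C) fun m => ?_
    rw [norm_mul, Real.norm_of_nonneg (hw0 m), mul_left_comm]
    exact mul_le_mul_of_nonneg_left (hclose m) (hw0 m)

end IsDeathRate

/-! ### Outcome laws of distinct photon numbers separate -/

/-- The change of the photon number by an outcome. -/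
def photonShift : Bool × Bool → ℕ → ℕ
  | (false, true), n => n - 1
  | (true, false), n => n + 1
  | _, n => n

/-- Outcome amplitudes for which the photon number is the birth-death chain with death
rates `b`. -/
structure IsOutcomeAmplitude (x : ℝ) (b : ℕ → ℝ) (v : Bool × Bool → ℕ → ℂ) : Prop where
  down : ∀ n, ‖v (false, true) n‖ ^ 2 = b n
  up : ∀ n, ‖v (true, false) n‖ ^ 2 = x * b (n + 1)
  sum_eq_one : ∀ n, ∑ y, ‖v y n‖ ^ 2 = 1

namespace IsOutcomeAmplitude

variable {x : ℝ} {b : ℕ → ℝ} {v : Bool × Bool → ℕ → ℂ}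

theorem hold (hv : IsOutcomeAmplitude x b v) (n : ℕ) :
    ‖v (false, false) n‖ ^ 2 + ‖v (true, true) n‖ ^ 2 = 1 - x * b (n + 1) - b n := by
  have h := hv.sum_eq_one n
  simp only [Fintype.sum_prod_type, Fintype.sum_bool, hv.down, hv.up] at h
  linarith

theorem jumpOp_eq (hv : IsOutcomeAmplitude x b v) :
    jumpOp v photonShift = chainOp x b := by
  funext g n
  rw [chainOp, triOp_apply, ← hv.hold, ← hv.up, ← hv.down]
  simp only [jumpOp, Fintype.sum_prod_type, Fintype.sum_bool, photonShift]
  ring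

theorem jumpOp_iterate_eq (hv : IsOutcomeAmplitude x b v) (t : ℕ) :
    (jumpOp v photonShift)^[t] = ⇑(chainOp x b ^ t) := by
  rw [hv.jumpOp_eq, Module.End.coe_pow]

/-- The affinity of the outcome laws for `n` and `n + d` photons is bounded through the
Cauchy-Schwarz inequality, where only outcomes that are possible for both initial photon numbers
contribute. The larger photon number must not fall below `d` for the outcome to be possible for the
smaller one. -/
theorem affinity_sq_le (hv : IsOutcomeAmplitude x b v) (hb : IsDeathRate x b) (d t n : ℕ) :
    affinity (wordWeight v photonShift t) n (n + d) ^ 2 ≤ (killedOp x b d ^ t) 1 n := by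
  induction t generalizing n with
  | zero => simp [affinity_wordWeight_zero]
  | succ t ih =>
    set A : ℕ → ℕ → ℝ := affinity (wordWeight v photonShift t) with hA
    set g : Bool × Bool → ℝ := fun y =>
      if y = (false, true) ∧ n = 0 then 0
      else ‖v y (n + d)‖ * A (photonShift y n) (photonShift y (n + d)) with hg
    have e1 : affinity (wordWeight v photonShift (t + 1)) n (n + d) = ∑ y, ‖v y n‖ * g y := by
      rw [affinity_wordWeight_succ]
      refine Finset.sum_congr rfl fun y _ => ?_
      rw [hg]
      dsimp only
      split_ifs with h
      · have h0 : ‖v y n‖ ^ 2 = 0 := by rw [h.1, h.2, hv.down, hb.zero]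
        rw [pow_eq_zero_iff two_ne_zero] at h0
        simp [h0]
      · rw [mul_assoc]
    have e2 : (∑ y, ‖v y n‖ * g y) ^ 2 ≤ ∑ y, g y ^ 2 := by
      have := Finset.sum_mul_sq_le_sq_mul_sq Finset.univ (fun y => ‖v y n‖) g
      rwa [hv.sum_eq_one, one_mul] at this
    rw [e1]
    refine e2.trans ?_
    rw [pow_succ']
    change _ ≤ killedOp x b d ((killedOp x b d ^ t) 1) n
    set q : ℕ → ℝ := (killedOp x b d ^ t) 1 with hq
    have hup := mul_le_mul_of_nonneg_left (ih (n + 1)) (sq_nonneg ‖v (true, false) (n + d)‖)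
    have hff := mul_le_mul_of_nonneg_left (ih n) (sq_nonneg ‖v (false, false) (n + d)‖)
    have htt := mul_le_mul_of_nonneg_left (ih n) (sq_nonneg ‖v (true, true) (n + d)‖)
    have eup : n + 1 + d = n + d + 1 := by ring
    rw [eup] at hup
    have hsum : ∑ y, g y ^ 2 ≤ ‖v (true, false) (n + d)‖ ^ 2 * q (n + 1) +
        (‖v (false, false) (n + d)‖ ^ 2 + ‖v (true, true) (n + d)‖ ^ 2) * q n +
        (if n = 0 then 0 else ‖v (false, true) (n + d)‖ ^ 2) * q (n - 1) := by
      have hdown : g (false, true) ^ 2 ≤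
          (if n = 0 then 0 else ‖v (false, true) (n + d)‖ ^ 2) * q (n - 1) := by
        cases n with
        | zero => simp [hg]
        | succ n =>
          have h1 := mul_le_mul_of_nonneg_left (ih n) (sq_nonneg ‖v (false, true) (n + 1 + d)‖)
          have e3 : n + 1 + d - 1 = n + d := by omega
          simpa [hg, photonShift, e3, mul_pow] using h1
      have h2 : g (true, false) = ‖v (true, false) (n + d)‖ * A (n + 1) (n + d + 1) := by
        simp [hg, photonShift]
      have h3 : g (false, false) = ‖v (false, false) (n + d)‖ * A n (n + d) := by
        simp [hg, photonShift]
      have h4 : g (true, true) = ‖v (true, true) (n + d)‖ * A n (n + d) := by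
        simp [hg, photonShift]
      simp only [Fintype.sum_prod_type, Fintype.sum_bool]
      rw [h2, h3, h4, mul_pow, mul_pow, mul_pow]
      linarith
    refine hsum.trans (le_of_eq ?_)
    rw [hv.up, hv.hold, hv.down, killedOp, triOp_apply]

theorem tendsto_affinity (hv : IsOutcomeAmplitude x b v) (hb : IsDeathRate x b) {m n : ℕ}
    (hmn : m ≠ n) :
    Tendsto (fun t => affinity (wordWeight v photonShift t) m n) atTop (𝓝 0) := by
  wlog h : m < n generalizing m n
  · have := this hmn.symm (lt_of_le_of_ne (not_lt.1 h) hmn.symm)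
    simpa only [affinity_comm] using this
  obtain ⟨d, rfl⟩ : ∃ d, n = m + (d + 1) := ⟨n - m - 1, by omega⟩
  have h2 : Tendsto (fun t => affinity (wordWeight v photonShift t) m (m + (d + 1)) ^ 2)
      atTop (𝓝 0) :=
    squeeze_zero (fun t => sq_nonneg _) (fun t => hv.affinity_sq_le hb (d + 1) t m)
      (hb.tendsto_killedOp_pow_one d m)
  have h3 := h2.sqrt
  rw [Real.sqrt_zero] at h3
  exact h3.congr fun t => Real.sqrt_sq (affinity_nonneg _ _ _)

end IsOutcomeAmplitude

/-! ### The Kraus operators of the maser -/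

theorem fockBasis_apply (n k : ℕ) : (fockBasis n : FockSpace) k = if k = n then 1 else 0 := by
  have h : fockBasis n = lp.single 2 n (1 : ℂ) := by
    rw [← fockBasis.repr_symm_single]
    rfl
  rw [h, lp.single_apply, Pi.single_apply]

namespace MaserParams

variable (p : MaserParams)

/-- The probability `ξ n sin²(π√(ξn+η)) / (ξn+η)` that an atom and the field, with `n`
excitations in total, exchange a photon. -/
noncomputable def rabi (n : ℕ) : ℝ :=
  p.ξ * n * (Real.sin (Real.pi * √(p.ξ * n + p.η)) ^ 2 / (p.ξ * n + p.η))

theorem rabi_zero : p.rabi 0 = 0 := by simp [rabi]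

theorem norm_sinFn_mul_sq (n : ℕ) : ‖p.sinFn n * (√(n : ℝ) : ℂ)‖ ^ 2 = p.rabi n := by
  have hξ : 0 ≤ p.ξ := by unfold ξ; positivity
  rw [sinFn, ← Complex.ofReal_mul, Complex.norm_real, Real.norm_eq_abs, sq_abs, mul_pow, mul_pow,
    div_pow, Real.sq_sqrt hξ, Real.sq_sqrt (p.arg_nonneg n), Real.sq_sqrt (Nat.cast_nonneg n), rabi]
  ring

theorem norm_cosFn_sq {δ : ℝ} (hδ : δ ^ 2 = p.η) (n : ℕ) : ‖p.cosFn δ n‖ ^ 2 = 1 - p.rabi n := by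
  have h0 := p.arg_nonneg n
  have h1 : p.cosFn δ n = ((Real.cos (Real.pi * √(p.ξ * n + p.η)) : ℝ) : ℂ) +
      ((δ * (Real.sin (Real.pi * √(p.ξ * n + p.η)) / √(p.ξ * n + p.η)) : ℝ) : ℂ) * Complex.I := by
    rw [cosFn, mul_comm Complex.I]
  rw [h1, ← Complex.normSq_eq_norm_sq, Complex.normSq_add_mul_I, mul_pow, div_pow,
    Real.sq_sqrt h0, hδ, rabi]
  have h2 := Real.sin_sq_add_cos_sq (Real.pi * √(p.ξ * n + p.η))
  rcases h0.eq_or_lt with h | h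
  · rw [← h]; simp
  · field_simp
    linear_combination (p.ξ * n + p.η) * h2

theorem rabi_le_one (n : ℕ) : p.rabi n ≤ 1 := by
  rw [← norm_sinFn_mul_sq]
  exact pow_le_one₀ (norm_nonneg _) (p.norm_sinFn_mul_le n)

theorem rabi_pos (hlam : p.lam ≠ 0) (hτ : 0 < p.τ) (hres : p.NonResonant) (n : ℕ) :
    0 < p.rabi (n + 1) := by
  have hξ : 0 < p.ξ := by
    unfold ξ
    have : p.lam * p.τ / Real.pi ≠ 0 := div_ne_zero (mul_ne_zero hlam hτ.ne') Real.pi_ne_zero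
    positivity
  have hη : 0 ≤ p.η := by unfold η; positivity
  have hx : 0 < p.ξ * (n + 1 : ℕ) + p.η := by positivity
  have hsin : Real.sin (Real.pi * √(p.ξ * (n + 1 : ℕ) + p.η)) ≠ 0 := by
    intro h0
    obtain ⟨k, hk⟩ := Real.sin_eq_zero_iff.1 h0
    have hk' : (k : ℝ) = √(p.ξ * (n + 1 : ℕ) + p.η) := by
      have := Real.pi_pos.ne'
      rw [mul_comm] at hk
      exact mul_left_cancel₀ this hk
    have hkpos : 0 < (k : ℝ) := hk' ▸ Real.sqrt_pos.2 hx
    have hkpos' : 0 < k := by exact_mod_cast hkpos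
    obtain ⟨m, rfl⟩ := Int.eq_ofNat_of_zero_le hkpos'.le
    refine hres ⟨n + 1, m, n.succ_pos, by exact_mod_cast hkpos', ?_⟩
    have : (m : ℝ) = √(p.ξ * (n + 1 : ℕ) + p.η) := by exact_mod_cast hk'
    rw [this, Real.sq_sqrt hx.le]
  unfold rabi
  have : 0 < Real.sin (Real.pi * √(p.ξ * (n + 1 : ℕ) + p.η)) ^ 2 := by positivity
  positivity

/-- The death rates of the photon number. -/
noncomputable def deathRate (n : ℕ) : ℝ := p.atomProb false * p.rabi n

theorem atomProb_false_pos : 0 < p.atomProb false := by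
  have := Real.exp_pos (-p.β * p.ε)
  exact div_pos one_pos (by linarith)

theorem atomProb_true_eq : p.atomProb true = Real.exp (-p.β * p.ε) * p.atomProb false := by
  simp [atomProb, div_eq_mul_inv]

theorem atomProb_mul : (1 + Real.exp (-p.β * p.ε)) * p.atomProb false = 1 := by
  have := Real.exp_pos (-p.β * p.ε)
  rw [atomProb, mul_one_div_cancel (by linarith)]

theorem isDeathRate (hε : 0 < p.ε) (hlam : p.lam ≠ 0) (hτ : 0 < p.τ) (hβ : 0 < p.β)
    (hres : p.NonResonant) : IsDeathRate (Real.exp (-p.β * p.ε)) p.deathRate where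
  x_pos := Real.exp_pos _
  x_lt_one := by
    rw [Real.exp_lt_one_iff]
    nlinarith [mul_pos hβ hε]
  zero := by simp [deathRate, rabi_zero]
  pos n := mul_pos p.atomProb_false_pos (p.rabi_pos hlam hτ hres n)
  le n := by
    rw [deathRate, ← mul_assoc, atomProb_mul, one_mul]
    exact p.rabi_le_one n

/-- The factors `v y n` in `V y |n⟩ = v y n |photonShift y n⟩`. -/
noncomputable def krausAmplitude (ω δ : ℝ) : Bool × Bool → ℕ → ℂ
  | (false, false), n =>
      √(p.atomProb false) * (Complex.exp (-Complex.I * p.τ * ω * n) * p.cosFn δ n)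
  | (false, true), n => √(p.atomProb false) *
      (Complex.exp (-Complex.I * p.τ * ω * (n - 1 : ℕ)) * (p.sinFn n * (√(n : ℝ) : ℂ)))
  | (true, false), n => √(p.atomProb true) *
      (Complex.exp (-Complex.I * p.τ * ω * (n + 1 : ℕ)) *
        (p.sinFn (n + 1) * (√((n + 1 : ℕ) : ℝ) : ℂ)))
  | (true, true), n => √(p.atomProb true) *
      (Complex.exp (-Complex.I * p.τ * ω * n) * (starRingEnd ℂ) (p.cosFn δ (n + 1)))

theorem isWeightedShift_kraus (ω δ : ℝ) (y : Bool × Bool) :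
    IsWeightedShift fockBasis (p.kraus ω δ y) (p.krausAmplitude ω δ y) (photonShift y) where
  apply_basis n := by
    ext k
    rw [kraus_apply]
    change _ = p.krausAmplitude ω δ y n * (fockBasis (photonShift y n) : FockSpace) k
    match y with
    | (false, false) =>
      simp only [krausSeq, phase, ofNumber, krausAmplitude, photonShift, LinearMap.smul_apply,
        LinearMap.comp_apply, LinearMap.coe_mk, AddHom.coe_mk, Pi.smul_apply, smul_eq_mul,
        fockBasis_apply]
      by_cases h : k = n
      · simp only [if_pos, h]; ring
      · simp only [if_neg h, mul_zero]
    | (true, true) =>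
      simp only [krausSeq, phase, ofNumber, krausAmplitude, photonShift, LinearMap.smul_apply,
        LinearMap.comp_apply, LinearMap.coe_mk, AddHom.coe_mk, Pi.smul_apply, smul_eq_mul,
        fockBasis_apply]
      by_cases h : k = n
      · simp only [if_pos, h]; ring
      · simp only [if_neg h, mul_zero]
    | (true, false) =>
      simp only [krausSeq, phase, ofNumber, krausAmplitude, photonShift, LinearMap.smul_apply,
        LinearMap.comp_apply, LinearMap.coe_mk, AddHom.coe_mk, Pi.smul_apply, smul_eq_mul,
        fockBasis_apply, creation]
      cases k with
      | zero => simp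
      | succ k =>
        simp only [Nat.add_sub_cancel, add_left_inj]
        by_cases h : k = n
        · simp only [if_pos, h]; ring
        · simp only [if_neg h, mul_zero]
    | (false, true) =>
      simp only [krausSeq, phase, ofNumber, krausAmplitude, photonShift, LinearMap.smul_apply,
        LinearMap.comp_apply, LinearMap.coe_mk, AddHom.coe_mk, Pi.smul_apply, smul_eq_mul,
        fockBasis_apply, annihilation]
      cases n with
      | zero => simp
      | succ n =>
        simp only [Nat.add_sub_cancel, add_left_inj]
        by_cases h : k = n
        · simp only [if_pos, h]; push_cast; ring
        · simp only [if_neg h, mul_zero]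
  inj m n hm hn h := by
    match y with
    | (false, false) => exact h
    | (true, true) => exact h
    | (true, false) => exact Nat.succ_injective h
    | (false, true) =>
      have h0 : ∀ n, p.krausAmplitude ω δ (false, true) n ≠ 0 → n ≠ 0 := by
        rintro n hn rfl
        simp [krausAmplitude] at hn
      have h1 := h0 m hm
      have h2 := h0 n hn
      have h3 : m - 1 = n - 1 := h
      omega

theorem isOutcomeAmplitude {ω δ : ℝ} (hδ : δ ^ 2 = p.η) :
    IsOutcomeAmplitude (Real.exp (-p.β * p.ε)) p.deathRate (p.krausAmplitude ω δ) := by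
  have hnorm : ∀ σ (n : ℕ) (z : ℂ),
      ‖(√(p.atomProb σ) : ℂ) * (Complex.exp (-Complex.I * p.τ * ω * n) * z)‖ ^ 2 =
        p.atomProb σ * ‖z‖ ^ 2 := fun σ n z => by
    have h0 : 0 ≤ p.atomProb σ := by
      cases σ
      · exact p.atomProb_false_pos.le
      · rw [atomProb_true_eq]
        exact mul_nonneg (Real.exp_pos _).le p.atomProb_false_pos.le
    rw [norm_mul, norm_mul, norm_phase, one_mul, Complex.norm_real,
      Real.norm_of_nonneg (Real.sqrt_nonneg _), mul_pow, Real.sq_sqrt h0]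
  have hff : ∀ n, ‖p.krausAmplitude ω δ (false, false) n‖ ^ 2 =
      p.atomProb false * (1 - p.rabi n) := fun n => by
    rw [krausAmplitude, hnorm, p.norm_cosFn_sq hδ]
  have htt : ∀ n, ‖p.krausAmplitude ω δ (true, true) n‖ ^ 2 =
      p.atomProb true * (1 - p.rabi (n + 1)) := fun n => by
    rw [krausAmplitude, hnorm, RCLike.norm_conj, p.norm_cosFn_sq hδ]
  have hft : ∀ n, ‖p.krausAmplitude ω δ (false, true) n‖ ^ 2 =
      p.atomProb false * p.rabi n := fun n => by
    rw [krausAmplitude, hnorm, norm_sinFn_mul_sq]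
  have htf : ∀ n, ‖p.krausAmplitude ω δ (true, false) n‖ ^ 2 =
      p.atomProb true * p.rabi (n + 1) := fun n => by
    rw [krausAmplitude, hnorm, norm_sinFn_mul_sq]
  refine ⟨hft, fun n => ?_, fun n => ?_⟩
  · rw [htf, atomProb_true_eq, deathRate, mul_assoc]
  · simp only [Fintype.sum_prod_type, Fintype.sum_bool, hff, htt, hft, htf, atomProb_true_eq]
    linear_combination p.atomProb_mul

/-! ### The stationary mixture of Fock states -/

theorem boltzmann_basis (h : 0 ≤ p.β * p.ε) (n : ℕ) :
    p.boltzmann (fockBasis n) = ((Real.exp (-p.β * p.ε) ^ n : ℝ) : ℂ) • fockBasis n := by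
  ext k
  rw [p.boltzmann_apply h]
  change _ = ((Real.exp (-p.β * p.ε) ^ n : ℝ) : ℂ) * (fockBasis n : FockSpace) k
  rw [fockBasis_apply, ← Real.exp_nat_mul]
  split_ifs with hk
  · rw [hk, mul_comm (n : ℝ)]
  · simp

theorem inner_boltzmann (h : 0 ≤ p.β * p.ε) (n : ℕ) :
    ⟪fockBasis n, p.boltzmann (fockBasis n)⟫_ℂ = ((Real.exp (-p.β * p.ε) ^ n : ℝ) : ℂ) := by
  rw [p.boltzmann_basis h, inner_smul_right, inner_self_eq_norm_sq_to_K,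
    fockBasis.orthonormal.1 n]
  simp

theorem re_inner_rhoInv (h : 0 < p.β * p.ε) (n : ℕ) :
    RCLike.re ⟪fockBasis n, p.rhoInv (fockBasis n)⟫_ℂ =
      (1 - Real.exp (-p.β * p.ε)) * Real.exp (-p.β * p.ε) ^ n := by
  have hx : Real.exp (-p.β * p.ε) < 1 := by
    rw [Real.exp_lt_one_iff]
    linarith
  have htr : opTrace fockBasis p.boltzmann = (((1 - Real.exp (-p.β * p.ε))⁻¹ : ℝ) : ℂ) := by
    rw [← tsum_geometric_of_lt_one (Real.exp_pos _).le hx, Complex.ofReal_tsum, opTrace]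
    exact tsum_congr fun n => p.inner_boltzmann h.le n
  rw [rhoInv, smul_apply, inner_smul_right, p.inner_boltzmann h.le, htr, ← Complex.ofReal_inv,
    inv_inv, ← Complex.ofReal_mul]
  exact Complex.ofReal_re _

end MaserParams

/-! ### Integrals over density operators -/

section Integrals

set_option linter.unusedSectionVars false

variable {ι : Type*} {H : Type*} [NormedAddCommGroup H] [InnerProductSpace ℂ H] [CompleteSpace H]
  {b : HilbertBasis ι ℂ H}

theorem abs_sub_basisState_le {f : DensityOp b → ℝ} (hf : LipschitzWith 1 f) (ρ : DensityOp b)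
    (i : ι) : |f ρ - f (basisState b i)| ≤ 4 := by
  have h := hf.dist_le_mul ρ (basisState b i)
  rw [NNReal.coe_one, one_mul, Real.dist_eq] at h
  exact h.trans (ρ.dist_basisState_le_four i)

theorem integrable_of_abs_le {ν : Measure (DensityOp b)} [IsFiniteMeasure ν] {f : DensityOp b → ℝ}
    (hf : Measurable f) {C : ℝ} (hC : ∀ ρ, |f ρ| ≤ C) : Integrable f ν :=
  Integrable.of_bound hf.aestronglyMeasurable C (Eventually.of_forall hC)

theorem integral_bind_of_abs_le {ν : Measure (DensityOp b)} [IsProbabilityMeasure ν]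
    {κ : Kernel (DensityOp b) (DensityOp b)} [IsMarkovKernel κ] {f : DensityOp b → ℝ}
    (hf : Measurable f) {C : ℝ} (hC : ∀ ρ, |f ρ| ≤ C) :
    ∫ ρ, f ρ ∂(ν.bind κ) = ∫ ρ, ∫ σ, f σ ∂(κ ρ) ∂ν := by
  have h := Kernel.integral_comp (κ := Kernel.const Unit ν) (η := κ) (a := ()) (f := f)
    (integrable_of_abs_le hf hC)
  rw [Kernel.comp_apply, Kernel.const_apply] at h
  exact h

theorem population_basisState [DecidableEq ι] (i j : ι) :
    (basisState b i).population j = if j = i then 1 else 0 := by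
  change RCLike.re ⟪b j, InnerProductSpace.rankOne ℂ (b i) (b i) (b j)⟫_ℂ = _
  have ho := orthonormal_iff_ite.1 b.orthonormal
  rw [InnerProductSpace.rankOne_apply, inner_smul_right, ho, ho]
  by_cases h : j = i
  · simp [h]
  · simp [h, Ne.symm h]

theorem DensityOp.eq_basisState (ρ : DensityOp b) {i : ι} (h : ρ.population i = 1) :
    ρ = basisState b i := by
  have := ρ.dist_basisState_le i
  rw [h, sub_self, Real.sqrt_zero, mul_zero] at this
  exact dist_le_zero.1 this

theorem outcomeProb_basisState {V : H →L[ℂ] H} {v : ι → ℂ} {σ : ι → ι}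
    (hV : IsWeightedShift b V v σ) (i : ι) : outcomeProb V (basisState b i) = ‖v i‖ ^ 2 := by
  classical
  refine (hV.hasSum_outcomeProb (basisState b i)).unique ?_
  simp only [population_basisState, mul_ite, mul_one, mul_zero]
  exact hasSum_ite_eq i _ |>.congr_fun fun j => by
    by_cases h : j = i <;> simp [h]

theorem postState_basisState {V : H →L[ℂ] H} {v : ι → ℂ} {σ : ι → ι}
    (hV : IsWeightedShift b V v σ) {i : ι} (hi : v i ≠ 0) :
    postState V (basisState b i) = basisState b (σ i) := by
  classical
  have h0 : ‖v i‖ ^ 2 ≠ 0 := pow_ne_zero 2 (norm_ne_zero_iff.2 hi)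
  have h1 : outcomeProb V (basisState b i) ≠ 0 := by rwa [outcomeProb_basisState hV]
  apply DensityOp.eq_basisState
  rw [hV.population_postState _ hi h1, outcomeProb_basisState hV, population_basisState, if_pos rfl,
    mul_one, div_self h0]

theorem integral_trajectoryKernel_basisState {R : Type*} [Fintype R] {V : R → H →L[ℂ] H}
    {v : R → ι → ℂ} {σ : R → ι → ι} (hV : ∀ y, IsWeightedShift b (V y) (v y) (σ y))
    {f : DensityOp b → ℝ} (hf : Measurable f) (i : ι) :
    ∫ ρ, f ρ ∂(trajectoryKernel b V (basisState b i)) =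
      jumpOp v σ (fun j => f (basisState b j)) i := by
  rw [integral_trajectoryKernel V _ hf, jumpOp]
  refine Finset.sum_congr rfl fun y _ => ?_
  rw [outcomeProb_basisState (hV y)]
  by_cases hi : v y i = 0
  · simp [hi]
  · rw [postState_basisState (hV y) hi]

end Integrals

namespace MaserParams

variable (p : MaserParams)

theorem isProbabilityMeasure_nuInv (h : 0 < p.β * p.ε) : IsProbabilityMeasure p.nuInv := by
  have hx : Real.exp (-p.β * p.ε) < 1 := by
    rw [Real.exp_lt_one_iff]
    linarith
  have hx0 := Real.exp_pos (-p.β * p.ε)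
  have hs := (hasSum_geometric_of_lt_one hx0.le hx).mul_left (1 - Real.exp (-p.β * p.ε))
  rw [mul_inv_cancel₀ (sub_pos.2 hx).ne'] at hs
  refine ⟨?_⟩
  simp only [nuInv, Measure.sum_apply _ MeasurableSet.univ, Measure.smul_apply, measure_univ,
    smul_eq_mul, mul_one, p.re_inner_rhoInv h]
  rw [← ENNReal.ofReal_tsum_of_nonneg _ hs.summable, hs.tsum_eq, ENNReal.ofReal_one]
  intro n
  have := sub_pos.2 hx
  positivity

theorem integral_nuInv (h : 0 < p.β * p.ε) {f : DensityOp fockBasis → ℝ} (hf : Measurable f)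
    {C : ℝ} (hC : ∀ ρ, |f ρ| ≤ C) :
    ∫ ρ, f ρ ∂p.nuInv = ∑' n : ℕ, (1 - Real.exp (-p.β * p.ε)) * Real.exp (-p.β * p.ε) ^ n *
      f (basisState fockBasis n) := by
  have hx : Real.exp (-p.β * p.ε) < 1 := by
    rw [Real.exp_lt_one_iff]
    linarith
  have hx0 := Real.exp_pos (-p.β * p.ε)
  have := p.isProbabilityMeasure_nuInv h
  have hint : Integrable f p.nuInv := integrable_of_abs_le hf hC
  have h1 := (hasSum_integral_measure hint).tsum_eq
  refine h1.symm.trans (tsum_congr fun n => ?_)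
  rw [integral_smul_measure, integral_dirac' _ _ hf.stronglyMeasurable, p.re_inner_rhoInv h,
    ENNReal.toReal_ofReal, smul_eq_mul]
  · rfl
  · have := sub_pos.2 hx
    positivity

variable {p} in
theorem invariant_nuInv {ω δ : ℝ}
    (hb : IsDeathRate (Real.exp (-p.β * p.ε)) p.deathRate) (h : 0 < p.β * p.ε)
    (hδ : δ ^ 2 = p.η) : Kernel.Invariant (p.kernel ω δ) p.nuInv := by
  have hprob := p.isProbabilityMeasure_nuInv h
  have hV := p.isWeightedShift_kraus ω δ
  have hv := p.isOutcomeAmplitude (ω := ω) hδ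
  have hK : IsMarkovKernel (p.kernel ω δ) := isMarkovKernel_trajectoryKernel hV hv.sum_eq_one
  change p.nuInv.bind (p.kernel ω δ) = p.nuInv
  refine ext_of_forall_integral_eq_of_IsFiniteMeasure fun f => ?_
  have hfm : Measurable f := f.continuous.measurable
  have hfC : ∀ ρ, |f ρ| ≤ ‖f‖ := fun ρ => f.norm_coe_le_norm ρ
  have hint : ∀ ρ, |∫ σ, f σ ∂(p.kernel ω δ ρ)| ≤ ‖f‖ := fun ρ => by
    have := norm_integral_le_of_norm_le_const (f := f) (μ := p.kernel ω δ ρ) (Eventually.of_forall hfC)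
    simpa using this
  have hm : Measurable fun ρ => ∫ σ, f σ ∂(p.kernel ω δ ρ) := by
    have e : (fun ρ => ∫ σ, f σ ∂(p.kernel ω δ ρ)) = fun ρ =>
        ∑ y, outcomeProb (p.kraus ω δ y) ρ * f (postState (p.kraus ω δ y) ρ) :=
      funext fun ρ => integral_trajectoryKernel _ ρ hfm
    rw [e]
    exact Finset.measurable_fun_sum _ fun y _ =>
      (continuous_outcomeProb _).measurable.mul (hfm.comp (measurable_postState _))
  rw [integral_bind_of_abs_le hfm hfC, p.integral_nuInv h hm hint, p.integral_nuInv h hfm hfC]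
  have := (hb.hasSum_geometric_mul_chainOp (f := fun n => f (basisState fockBasis n))
    fun n => hfC _).tsum_eq
  rw [← hv.jumpOp_eq] at this
  rw [← this]
  exact tsum_congr fun n => by rw [kernel, integral_trajectoryKernel_basisState hV hfm]

variable {p} in
/-- Convergence of the iterates of `Π`, uniformly over Lipschitz functions. The bound on the
integral of a function against `Πᵗ(ρ, ·)` depends on `ρ` only through the mass of the populations
outside a finite set, whose mean over `ν` is small. -/
theorem exists_forall_abs_integral_sub_le {ω δ : ℝ}
    (hb : IsDeathRate (Real.exp (-p.β * p.ε)) p.deathRate) (h : 0 < p.β * p.ε)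
    (hδ : δ ^ 2 = p.η) (ν : Measure (DensityOp fockBasis)) [IsProbabilityMeasure ν] {ε : ℝ}
    (hε : 0 < ε) : ∃ T, ∀ t ≥ T, ∀ f : DensityOp fockBasis → ℝ, LipschitzWith 1 f →
      |∫ ρ, f ρ ∂((fun μ => μ.bind (p.kernel ω δ))^[t] ν) - ∫ ρ, f ρ ∂p.nuInv| ≤ ε := by
  have hprob := p.isProbabilityMeasure_nuInv h
  have hV := p.isWeightedShift_kraus ω δ
  have hv := p.isOutcomeAmplitude (ω := ω) hδ
  set x := Real.exp (-p.β * p.ε)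
  set v := p.krausAmplitude ω δ
  choose e he0 he using hb.exists_abs_chainOp_pow_sub_le
  set θ : ℝ := ε / 16 with hθdef
  have hθ : 0 < θ := by positivity
  set tail : ℕ → DensityOp fockBasis → ℝ := fun M ρ =>
    1 - ∑ n ∈ Finset.range M, ρ.population n with htail
  have htail_nonneg : ∀ M ρ, 0 ≤ tail M ρ := fun M ρ => sub_nonneg.2
    (sum_le_hasSum _ (fun n _ => ρ.population_nonneg n) ρ.hasSum_population)
  have htail_le : ∀ M ρ, |tail M ρ| ≤ 1 := fun M ρ => by
    rw [abs_of_nonneg (htail_nonneg M ρ)]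
    exact sub_le_self _ (Finset.sum_nonneg fun n _ => ρ.population_nonneg n)
  have htail_cont : ∀ M, Continuous (tail M) := fun M =>
    continuous_const.sub (continuous_finsetSum _ fun n _ => DensityOp.continuous_population n)
  have htail_int : ∀ M, Integrable (tail M) ν := fun M =>
    integrable_of_abs_le (htail_cont M).measurable (htail_le M)
  have htail_lim : Tendsto (fun M => ∫ ρ, tail M ρ ∂ν) atTop (𝓝 0) := by
    have h0 : ∫ _ : DensityOp fockBasis, (0 : ℝ) ∂ν = 0 := integral_zero _ _
    rw [← h0]
    refine tendsto_integral_of_dominated_convergence (fun _ => 1)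
      (fun M => (htail_int M).aestronglyMeasurable) (integrable_const 1)
      (fun M => Eventually.of_forall (htail_le M)) (Eventually.of_forall fun ρ => ?_)
    have := ρ.hasSum_population.tendsto_sum_nat.const_sub 1
    rwa [sub_self] at this
  obtain ⟨M, hM⟩ : ∃ M, (8 / θ + 4) * ∫ ρ, tail M ρ ∂ν < ε / 4 := by
    have := htail_lim.const_mul (8 / θ + 4)
    rw [mul_zero] at this
    exact (this.eventually (gt_mem_nhds (by positivity))).exists
  set A : ℕ → ℝ := fun t => ∑ m ∈ Finset.range M, ∑ n ∈ (Finset.range M).erase m,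
    affinity (wordWeight v photonShift t) m n with hA
  set E : ℕ → ℝ := fun t => ∑ n ∈ Finset.range M, 4 * e n t with hE
  have hlim : Tendsto (fun t => 4 / θ * A t + E t) atTop (𝓝 0) := by
    have hA0 : Tendsto A atTop (𝓝 0) := by
      have := tendsto_finsetSum (Finset.range M) fun m _ =>
        tendsto_finsetSum ((Finset.range M).erase m) fun n hn =>
          hv.tendsto_affinity hb (Finset.ne_of_mem_erase hn).symm
      simpa using this
    have hE0 : Tendsto E atTop (𝓝 0) := by
      have := tendsto_finsetSum (Finset.range M) fun n _ => (he0 n).const_mul 4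
      simpa using this
    simpa using (hA0.const_mul (4 / θ)).add hE0
  obtain ⟨T, hT⟩ := eventually_atTop.1 (hlim.eventually (gt_mem_nhds (show 0 < ε / 4 by positivity)))
  refine ⟨T, fun t ht f hf => ?_⟩
  have hwV := isWeightedShift_wordOp hV t
  have hwv := sum_norm_wordWeight_sq (σ := photonShift) hv.sum_eq_one t
  have hwK : IsMarkovKernel (trajectoryKernel fockBasis (wordOp (p.kraus ω δ) t)) :=
    isMarkovKernel_trajectoryKernel hwV hwv
  rw [kernel, iterate_bind_trajectoryKernel]
  -- Subtracting the mean makes `g` bounded by `4` on Fock states and centered under `ν_inv`.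
  set c := ∫ ρ, f ρ ∂p.nuInv with hc
  set g : DensityOp fockBasis → ℝ := fun ρ => f ρ - c with hg
  have hfb : ∀ ρ, |f ρ| ≤ |f (basisState fockBasis 0)| + 4 := fun ρ => by
    have h1 := abs_sub_basisState_le hf ρ 0
    have h2 := abs_add_le (f ρ - f (basisState fockBasis 0)) (f (basisState fockBasis 0))
    rw [sub_add_cancel] at h2
    linarith
  have hfm := hf.continuous.measurable
  have hfint : ∀ (μ : Measure (DensityOp fockBasis)) [IsFiniteMeasure μ], Integrable f μ :=
    fun μ _ => integrable_of_abs_le hfm hfb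
  have hgl : LipschitzWith 1 g := LipschitzWith.of_dist_le_mul fun ρ σ => by
    simpa [hg] using hf.dist_le_mul ρ σ
  have hgint : ∀ (μ : Measure (DensityOp fockBasis)) [IsProbabilityMeasure μ],
      ∫ ρ, g ρ ∂μ = ∫ ρ, f ρ ∂μ - c := fun μ _ => by
    rw [hg, integral_sub (hfint μ) (integrable_const c)]
    simp
  have hg0 : ∫ ρ, g ρ ∂p.nuInv = 0 := by rw [hgint, hc, sub_self]
  have hg4 : ∀ i, |g (basisState fockBasis i)| ≤ 4 := fun i => by
    have h1 : g (basisState fockBasis i) =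
        -∫ ρ, (f ρ - f (basisState fockBasis i)) ∂p.nuInv := by
      rw [integral_sub (hfint _) (integrable_const _)]
      simp [hg, hc]
    rw [h1, abs_neg]
    have := norm_integral_le_of_norm_le_const (μ := p.nuInv)
      (f := fun ρ => f ρ - f (basisState fockBasis i))
      (Eventually.of_forall fun ρ => abs_sub_basisState_le hf ρ i)
    simpa using this
  have hgb : ∀ ρ, |g ρ| ≤ |f (basisState fockBasis 0)| + 4 + |c| := fun ρ =>
    (abs_sub _ _).trans (add_le_add (hfb ρ) le_rfl)
  have hgm := hgl.continuous.measurable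
  have hchain : ∀ n, |jumpOp (wordWeight v photonShift t) (wordTarget photonShift t)
      (fun k => g (basisState fockBasis k)) n| ≤ 4 * e n t := fun n => by
    have h1 := he n (fun k => g (basisState fockBasis k)) 4 hg4 t
    rw [← p.integral_nuInv h hgm hgb, hg0, sub_zero] at h1
    rwa [jumpOp_wordWeight, hv.jumpOp_iterate_eq]
  have hpoint : ∀ ρ, ‖∫ σ, g σ ∂(trajectoryKernel fockBasis (wordOp (p.kraus ω δ) t) ρ)‖ ≤
      4 * θ + (4 / θ * A t + E t) + (8 / θ + 4) * tail M ρ := fun ρ => by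
    have h1 := abs_integral_trajectoryKernel_le hwV hwv ρ (Finset.range M) hθ hgl hg4
    have h2 : ∑ n ∈ Finset.range M, |jumpOp (wordWeight v photonShift t)
        (wordTarget photonShift t) (fun k => g (basisState fockBasis k)) n| ≤ E t :=
      Finset.sum_le_sum fun n _ => hchain n
    have h3 : 4 * (θ + (A t + 2 * tail M ρ) / θ) + (E t + 4 * tail M ρ) =
        4 * θ + (4 / θ * A t + E t) + (8 / θ + 4) * tail M ρ := by ring
    rw [Real.norm_eq_abs, ← h3]
    exact h1.trans (by gcongr)
  have hbint : Integrable
      (fun ρ => 4 * θ + (4 / θ * A t + E t) + (8 / θ + 4) * tail M ρ) ν :=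
    (integrable_const _).add ((htail_int M).const_mul _)
  have hfinal := norm_integral_le_of_norm_le hbint (Eventually.of_forall hpoint)
  rw [← integral_bind_of_abs_le hgm hgb, integral_add (integrable_const _)
    ((htail_int M).const_mul _), integral_const_mul, hgint] at hfinal
  simp only [integral_const, probReal_univ, one_smul] at hfinal
  have hTt := hT t ht
  rw [← Real.norm_eq_abs]
  refine hfinal.trans ?_
  have : 4 * θ = ε / 4 := by rw [hθdef]; ring
  linarith

end MaserParams

theorem theorem2p2 (p : MaserParams) (hε₀ : 0 < p.ε₀) (hε : 0 < p.ε) (hlam : p.lam ≠ 0)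
    (hτ : 0 < p.τ) (hβ : 0 < p.β) (hres : p.NonResonant)
    (ω δ : ℝ) (hδ : δ ^ 2 = p.η) :
    IsProbabilityMeasure p.nuInv ∧
    (∀ ν : Measure (DensityOp fockBasis), IsProbabilityMeasure ν →
      (Kernel.Invariant (p.kernel ω δ) ν ↔ ν = p.nuInv)) ∧
    ∀ ν : Measure (DensityOp fockBasis), IsProbabilityMeasure ν →
      Tendsto (fun t : ℕ => wasserstein1 ((fun μ => μ.bind (p.kernel ω δ))^[t] ν) p.nuInv)
        atTop (𝓝 0) ∧
      ∀ f : BoundedContinuousFunction (DensityOp fockBasis) ℝ,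
        Tendsto (fun t : ℕ => ∫ ρ, f ρ ∂((fun μ => μ.bind (p.kernel ω δ))^[t] ν))
          atTop (𝓝 (∫ ρ, f ρ ∂p.nuInv)) := by
  have hβε : 0 < p.β * p.ε := mul_pos hβ hε
  have hb := p.isDeathRate hε hlam hτ hβ hres
  have hprob := p.isProbabilityMeasure_nuInv hβε
  have hV := p.isWeightedShift_kraus ω δ
  have hv := p.isOutcomeAmplitude (ω := ω) hδ
  have hiter : ∀ ν : Measure (DensityOp fockBasis), IsProbabilityMeasure ν → ∀ t : ℕ,
      IsProbabilityMeasure ((fun μ => μ.bind (p.kernel ω δ))^[t] ν) := fun ν hν t => by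
    have : IsMarkovKernel (trajectoryKernel fockBasis (wordOp (p.kraus ω δ) t)) :=
      isMarkovKernel_trajectoryKernel (isWeightedShift_wordOp hV t)
        (sum_norm_wordWeight_sq (σ := photonShift) hv.sum_eq_one t)
    rw [MaserParams.kernel, iterate_bind_trajectoryKernel]
    infer_instance
  have hweak : ∀ ν : Measure (DensityOp fockBasis), IsProbabilityMeasure ν →
      ∀ f : BoundedContinuousFunction (DensityOp fockBasis) ℝ,
        Tendsto (fun t : ℕ => ∫ ρ, f ρ ∂((fun μ => μ.bind (p.kernel ω δ))^[t] ν))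
          atTop (𝓝 (∫ ρ, f ρ ∂p.nuInv)) := by
    intro ν hν
    let μs : ℕ → ProbabilityMeasure (DensityOp fockBasis) := fun t => ⟨_, hiter ν hν t⟩
    let μ : ProbabilityMeasure (DensityOp fockBasis) := ⟨_, hprob⟩
    have hlim : Tendsto μs atTop (𝓝 μ) := by
      refine tendsto_iff_forall_lipschitz_integral_tendsto.2 fun f _ hf => ?_
      obtain ⟨L, hL⟩ := hf
      have hL1 : (0 : ℝ) < L + 1 := by positivity
      have hg : LipschitzWith 1 fun ρ => (L + 1 : ℝ)⁻¹ * f ρ :=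
        LipschitzWith.of_dist_le_mul fun ρ σ => by
          have h1 := hL.dist_le_mul ρ σ
          rw [Real.dist_eq] at h1 ⊢
          rw [← mul_sub, abs_mul, abs_of_pos (inv_pos.2 hL1), NNReal.coe_one, one_mul,
            inv_mul_le_iff₀ hL1]
          have := dist_nonneg (x := ρ) (y := σ)
          linarith
      have hglim : Tendsto (fun t => ∫ ρ, (L + 1 : ℝ)⁻¹ * f ρ ∂(μs t : Measure _)) atTop
          (𝓝 (∫ ρ, (L + 1 : ℝ)⁻¹ * f ρ ∂(μ : Measure _))) := by
        refine Metric.tendsto_atTop'.2 fun ε hε => ?_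
        obtain ⟨T, hT⟩ := MaserParams.exists_forall_abs_integral_sub_le (ω := ω) hb hβε hδ ν (half_pos hε)
        exact ⟨T, fun t ht => (hT t ht.le _ hg).trans_lt (half_lt_self hε)⟩
      have h2 := hglim.const_mul (L + 1 : ℝ)
      simp only [integral_const_mul, mul_inv_cancel_left₀ hL1.ne'] at h2
      exact h2
    exact ProbabilityMeasure.tendsto_iff_forall_integral_tendsto.1 hlim
  refine ⟨hprob, fun ν hν => ⟨fun hinv => ?_, fun h => ?_⟩, fun ν hν => ⟨?_, hweak ν hν⟩⟩
  · refine ext_of_forall_integral_eq_of_IsFiniteMeasure fun f => ?_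
    have h1 := hweak ν hν f
    have h2 : ∀ t : ℕ, (fun μ : Measure _ => μ.bind (p.kernel ω δ))^[t] ν = ν :=
      fun t => Function.iterate_fixed hinv.def t
    simp only [h2] at h1
    exact tendsto_nhds_unique tendsto_const_nhds h1
  · rw [h]
    exact MaserParams.invariant_nuInv hb hβε hδ
  · refine ENNReal.tendsto_atTop_zero.2 fun ε hε => ?_
    rcases eq_or_ne ε ⊤ with rfl | htop
    · exact ⟨0, fun _ _ => le_top⟩
    obtain ⟨T, hT⟩ := MaserParams.exists_forall_abs_integral_sub_le (ω := ω) hb hβε hδ ν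
      (ENNReal.toReal_pos hε.ne' htop)
    refine ⟨T, fun t ht => iSup₂_le fun f hf => ?_⟩
    refine ENNReal.ofReal_le_of_le_toReal ((le_abs_self _).trans (hT t ht f hf))
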